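/- For $t>0$ let $\vartheta(t)$ be the increment of the argument of $\pi^{-s/2}\Gamma(s/2)$ along the segment from $s=\tfrac12$ to $s=\tfrac12+it$. For an integer $n\ge 0$ let the Gram point $t_n$ be the (largest) positive root of $\vartheta(t_n)=\pi(n-1)$. Let $0<\gamma_1\le\gamma_2\le\dots$ be the positive ordinates of all zeros of the Riemann zeta function $\zeta(s)$, on the critical line or not, counted with multiplicity and numbered in ascending order. If $t_{m-1}<\gamma_n\le t_m$ with $m \ge 1$, put $\Delta_n=m-n$. Theorem 1. The sequence $\gamma_n$ is infinite, for every sufficiently large $n$ there is exactly one such $m$, and $\Delta_n=O(\ln n)$ as $n\to+\infty$. If the Riemann hypothesis is true, then $\Delta_n=O\bigl(\ln n/\ln\ln n\bigr)$ as $n\to+\infty$. -/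

import Mathlib

open Filter Asymptotics

noncomputable section

/-- `ϑ(t)`, for `t > 0`: the increment of the argument of `π ^ (-s/2) Γ(s/2)` (Mathlib's `Gammaℝ`)
along the segment from `1/2` to `1/2 + it`, that is, the imaginary part of the integral of
`Gammaℝ' / Gammaℝ` over that segment (with `ds = i du`, `Im (i z) = Re z`). -/
def rsTheta (t : ℝ) : ℝ :=
  ∫ u in (0 : ℝ)..t, (logDeriv Complex.Gammaℝ (1 / 2 + u * Complex.I)).re

/-- The Gram point `t_n`, `n ≥ 0`: the root `t > 0` of `ϑ(t) = π (n - 1)`. For `n ≥ 1` the positive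
root is unique. For `n = 0` there are two, one on each side of the minimum of `ϑ` near `2π`, and the
Gram point is the larger one, on the increasing branch of `ϑ`. -/
def gramPoint (n : ℕ) : ℝ :=
  sSup {t : ℝ | 0 < t ∧ rsTheta t = Real.pi * ((n : ℝ) - 1)}

/-- `ρ 1, ρ 2, …` lists all zeros of `ζ` in the upper half-plane, on the critical line or not, each
as often as its multiplicity, by ascending imaginary parts; zeros with equal imaginary parts come in
any order (the value `ρ 0` plays no role). The ordinates are `γ_n = Im (ρ n)`. -/
structure IsZetaZeroEnumeration (ρ : ℕ → ℂ) : Prop where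
  im_pos : ∀ n, 1 ≤ n → 0 < (ρ n).im
  im_mono : ∀ m n, 1 ≤ m → m ≤ n → (ρ m).im ≤ (ρ n).im
  encard_eq : ∀ s : ℂ, 0 < s.im →
    {n : ℕ | 1 ≤ n ∧ ρ n = s}.encard = analyticOrderAt riemannZeta s

/-- `x` lies in the Gram interval `G_m = (t_{m-1}, t_m]`, `m ≥ 1`. -/
def InGramInterval (x : ℝ) (m : ℕ) : Prop :=
  1 ≤ m ∧ gramPoint (m - 1) < x ∧ x ≤ gramPoint m

open Classical in
/-- `Δ_n = m - n`, where `m` is the index of the Gram interval that contains `γ_n`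
(and `0` if there is no such interval). -/
def gramDeviation (γ : ℕ → ℝ) (n : ℕ) : ℤ :=
  if h : ∃ m : ℕ, InGramInterval (γ n) m then (h.choose : ℤ) - (n : ℤ) else 0

end

/-! For large x, x lies in the m-th Gram interval exactly when m - 2 < ϑ(x)/π ≤ m - 1, so the index
belonging to γ_n is ϑ(γ_n)/π + O(1). On the other side, n is N(γ_n) up to the multiplicity at that
height, and the Riemann–von Mangoldt formula gives π N(T) = ϑ(T) - A(T) + O(1), where A(T) is the
variation of arg ζ from 1/2 + iT to 2 + iT. The main terms cancel: Δ_n is bounded by A near γ_n,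
plus O(1). As ϑ grows faster than any linear function, γ_n ≤ n for large n, and a bound A(T) =
O(F(T)) becomes Δ_n = O(F(n)) (`isBigO_gramDeviation`).

The formula (`exists_abs_pi_mul_zetaZeroCount_sub_le`) is the argument principle for Λ on [-1, 2] ×
[S, T], folded along the critical line by the functional equation. It also yields N(T) → ∞, hence
the existence of an enumeration.

Unconditionally, Landau's lemma (`exists_norm_logDeriv_sub_sum_le`) says that ζ'/ζ near height T is
a sum of 1/(z - ρ) over O(log T) nearby zeros plus O(log T). Each zero contributes O(1) to the
change of argument, so A(T) = O(log T).

Under RH that sum has nonnegative real part to the right of the critical line, so Re ζ'/ζ ≥ -B with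
B of order log T, while ζ'/ζ = O(1) for Re ≥ 3/2. A three circles argument then makes |ζ'/ζ| decay
like log T · exp(-(x - 1/2) log log T / 3). The integral over x ≥ 1/2 + h with h = 3 / log log T is
O(log T / log log T). On the remaining piece each zero is compared with its contribution at abscissa
1/2 + h, which saves a factor h. -/

/-! ### Factoring zeros out of an analytic function. -/

open Complex in
theorem exists_eq_prod_sub_pow_mul {f : ℂ → ℂ} {U : Set ℂ} (hf : AnalyticOnNhd ℂ f U)
    (Z : Finset ℂ) (hZ : ∀ ρ ∈ Z, ρ ∈ U) (ht : ∀ ρ ∈ Z, analyticOrderAt f ρ ≠ ⊤) :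
    ∃ g : ℂ → ℂ, AnalyticOnNhd ℂ g U ∧
      (∀ z, f z = (∏ ρ ∈ Z, (z - ρ) ^ analyticOrderNatAt f ρ) * g z) ∧ ∀ ρ ∈ Z, g ρ ≠ 0 := by
  classical
  induction Z using Finset.induction_on with
  | empty => exact ⟨f, hf, by simp, by simp⟩
  | insert ρ Z hρ ih =>
    obtain ⟨g, hg, hfg, hg0⟩ := ih (fun r hr => hZ r (by simp [hr])) (fun r hr => ht r (by simp [hr]))
    set P : ℂ → ℂ := fun z => ∏ r ∈ Z, (z - r) ^ analyticOrderNatAt f r with hP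
    have hPa : AnalyticAt ℂ P ρ := by rw [hP]; fun_prop
    have hPne : P ρ ≠ 0 := by
      simp only [hP, Finset.prod_ne_zero_iff]
      intro r hr
      exact pow_ne_zero _ (sub_ne_zero.2 (fun h => hρ (h ▸ hr)))
    have hρU : ρ ∈ U := hZ ρ (by simp)
    have hfe : f = P * g := funext hfg
    have hord : analyticOrderAt f ρ = analyticOrderAt g ρ := by
      rw [hfe, analyticOrderAt_mul hPa (hg ρ hρU), hPa.analyticOrderAt_eq_zero.2 hPne, zero_add]
    have hordn : analyticOrderNatAt f ρ = analyticOrderNatAt g ρ := by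
      simp [analyticOrderNatAt, hord]
    have hgt : analyticOrderAt g ρ ≠ ⊤ := hord ▸ ht ρ (by simp)
    obtain ⟨h, hha, hh0, hgh⟩ := (hg ρ hρU).analyticOrderAt_ne_top.1 hgt
    rw [← hordn] at hgh
    set n := analyticOrderNatAt f ρ
    -- The factorisation must hold at every point of ℂ, so the quotient is given its limit value at
    -- ρ.
    set g' : ℂ → ℂ := fun z => if z = ρ then h ρ else g z / (z - ρ) ^ n with hg'
    have hg'g : ∀ z, g z = (z - ρ) ^ n * g' z := by
      intro z
      by_cases hz : z = ρ
      · subst hz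
        simpa [hg'] using hgh.self_of_nhds
      · have : (z - ρ) ^ n ≠ 0 := pow_ne_zero _ (sub_ne_zero.2 hz)
        simp only [hg', if_neg hz]
        field_simp
    refine ⟨g', ?_, ?_, ?_⟩
    · intro z hz
      by_cases hzρ : z = ρ
      · subst hzρ
        refine hha.congr ?_
        filter_upwards [hgh] with w hw
        by_cases hwz : w = z
        · simp [hg', hwz]
        · have : (w - z) ^ n ≠ 0 := pow_ne_zero _ (sub_ne_zero.2 hwz)
          simp only [hg', if_neg hwz, hw, smul_eq_mul]
          field_simp
      · have : AnalyticAt ℂ (fun w => g w / (w - ρ) ^ n) z :=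
          (hg z hz).fun_div (by fun_prop) (pow_ne_zero _ (sub_ne_zero.2 hzρ))
        refine this.congr ?_
        filter_upwards [isOpen_ne.mem_nhds hzρ] with w hw
        simp [hg', if_neg hw]
    · intro z
      rw [Finset.prod_insert hρ, hfg z, hg'g z]
      ring
    · intro r hr hr0
      rcases Finset.mem_insert.1 hr with rfl | hr
      · exact hh0 (by simpa [hg'] using hr0)
      · exact hg0 r hr (by rw [hg'g r, hr0, mul_zero])

theorem logDeriv_eq_sum_add {f g : ℂ → ℂ} {Z : Finset ℂ} {n : ℂ → ℕ}
    (hfg : ∀ z, f z = (∏ ρ ∈ Z, (z - ρ) ^ n ρ) * g z) {z : ℂ} (hz : f z ≠ 0)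
    (hg : AnalyticAt ℂ g z) (hZ : ∀ ρ ∈ Z, z ≠ ρ) :
    logDeriv f z = ∑ ρ ∈ Z, (n ρ : ℂ) / (z - ρ) + logDeriv g z := by
  have hg0 : g z ≠ 0 := fun h => hz (by rw [hfg, h, mul_zero])
  have hP0 : ∀ ρ ∈ Z, (z - ρ) ^ n ρ ≠ 0 := fun ρ hρ => pow_ne_zero _ (sub_ne_zero.2 (hZ ρ hρ))
  have hfe : f = fun w => (∏ ρ ∈ Z, (w - ρ) ^ n ρ) * g w := funext hfg
  rw [hfe, logDeriv_mul z (Finset.prod_ne_zero_iff.2 hP0) hg0 (by fun_prop) hg.differentiableAt]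
  congr 1
  have := logDeriv_prod (s := Z) (f := fun ρ w => (w - ρ) ^ n ρ) (x := z) hP0
    (fun i _ => by fun_prop)
  rw [this]
  refine Finset.sum_congr rfl fun ρ _ => ?_
  rw [logDeriv_fun_pow (f := fun w : ℂ => w - ρ) (by fun_prop)]
  simp [logDeriv_apply, div_eq_mul_inv]

/-! ### Rectangle integrals and the argument principle. -/

noncomputable section

/-- The integral of `f` over the boundary of `[a, b] × [c, d]`, counterclockwise. -/
def rectIntegral (f : ℂ → ℂ) (a b c d : ℝ) : ℂ :=
  (∫ x : ℝ in a..b, f (x + c * Complex.I)) - (∫ x : ℝ in a..b, f (x + d * Complex.I)) +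
    Complex.I * (∫ y : ℝ in c..d, f (b + y * Complex.I)) -
    Complex.I * (∫ y : ℝ in c..d, f (a + y * Complex.I))

/-- The boundary of `[a, b] × [c, d]`. -/
def rectBoundary (a b c d : ℝ) : Set ℂ :=
  {z | (z.re ∈ Set.Icc a b ∧ (z.im = c ∨ z.im = d)) ∨ (z.im ∈ Set.Icc c d ∧ (z.re = a ∨ z.re = b))}

end

theorem rectIntegral_eq_zero {f : ℂ → ℂ} {a b c d : ℝ} (hab : a ≤ b) (hcd : c ≤ d)
    (hf : DifferentiableOn ℂ f (Set.Icc a b ×ℂ Set.Icc c d)) : rectIntegral f a b c d = 0 := by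
  have := Complex.integral_boundary_rect_eq_zero_of_differentiableOn f ⟨a, c⟩ ⟨b, d⟩
    (by simpa [Set.uIcc_of_le hab, Set.uIcc_of_le hcd] using hf)
  simpa [rectIntegral] using this

section RectContinuity
variable {f : ℂ → ℂ} {a b c d : ℝ}

theorem ContinuousOn.bottom_side (hf : ContinuousOn f (rectBoundary a b c d)) (hab : a ≤ b) :
    IntervalIntegrable (fun x : ℝ => f (x + c * Complex.I)) MeasureTheory.volume a b := by
  apply ContinuousOn.intervalIntegrable
  rw [Set.uIcc_of_le hab]
  refine hf.comp (by fun_prop) fun x hx => Or.inl ?_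
  simpa using hx

theorem ContinuousOn.top_side (hf : ContinuousOn f (rectBoundary a b c d)) (hab : a ≤ b) :
    IntervalIntegrable (fun x : ℝ => f (x + d * Complex.I)) MeasureTheory.volume a b := by
  apply ContinuousOn.intervalIntegrable
  rw [Set.uIcc_of_le hab]
  refine hf.comp (by fun_prop) fun x hx => Or.inl ?_
  simpa using hx

theorem ContinuousOn.right_side (hf : ContinuousOn f (rectBoundary a b c d)) (hcd : c ≤ d) :
    IntervalIntegrable (fun x : ℝ => f (b + x * Complex.I)) MeasureTheory.volume c d := by
  apply ContinuousOn.intervalIntegrable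
  rw [Set.uIcc_of_le hcd]
  refine hf.comp (by fun_prop) fun x hx => Or.inr ?_
  simpa using hx

theorem ContinuousOn.left_side (hf : ContinuousOn f (rectBoundary a b c d)) (hcd : c ≤ d) :
    IntervalIntegrable (fun x : ℝ => f (a + x * Complex.I)) MeasureTheory.volume c d := by
  apply ContinuousOn.intervalIntegrable
  rw [Set.uIcc_of_le hcd]
  refine hf.comp (by fun_prop) fun x hx => Or.inr ?_
  simpa using hx

end RectContinuity

theorem rectIntegral_add {f g : ℂ → ℂ} {a b c d : ℝ} (hab : a ≤ b) (hcd : c ≤ d)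
    (hf : ContinuousOn f (rectBoundary a b c d)) (hg : ContinuousOn g (rectBoundary a b c d)) :
    rectIntegral (fun z => f z + g z) a b c d = rectIntegral f a b c d + rectIntegral g a b c d := by
  simp only [rectIntegral]
  rw [intervalIntegral.integral_add (hf.bottom_side hab) (hg.bottom_side hab),
    intervalIntegral.integral_add (hf.top_side hab) (hg.top_side hab),
    intervalIntegral.integral_add (hf.right_side hcd) (hg.right_side hcd),
    intervalIntegral.integral_add (hf.left_side hcd) (hg.left_side hcd)]
  ring

theorem rectIntegral_const_mul (k : ℂ) (f : ℂ → ℂ) (a b c d : ℝ) :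
    rectIntegral (fun z => k * f z) a b c d = k * rectIntegral f a b c d := by
  simp only [rectIntegral, intervalIntegral.integral_const_mul]
  ring

theorem rectIntegral_finset_sum {f : ℂ → ℂ → ℂ} {Z : Finset ℂ} {a b c d : ℝ} (hab : a ≤ b)
    (hcd : c ≤ d) (hf : ∀ ρ ∈ Z, ContinuousOn (f ρ) (rectBoundary a b c d)) :
    rectIntegral (fun z => ∑ ρ ∈ Z, f ρ z) a b c d = ∑ ρ ∈ Z, rectIntegral (f ρ) a b c d := by
  classical
  induction Z using Finset.induction_on with
  | empty => simp [rectIntegral]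
  | insert ρ Z hρ ih =>
    simp only [Finset.sum_insert hρ]
    rw [rectIntegral_add hab hcd (hf ρ (by simp))
      (continuousOn_finsetSum _ fun r hr => hf r (by simp [hr])), ih fun r hr => hf r (by simp [hr])]

theorem rectIntegral_congr {f g : ℂ → ℂ} {a b c d : ℝ} (hab : a ≤ b) (hcd : c ≤ d)
    (h : Set.EqOn f g (rectBoundary a b c d)) :
    rectIntegral f a b c d = rectIntegral g a b c d := by
  simp only [rectIntegral]
  congr 1
  · congr 1
    · congr 1 <;>
      · refine intervalIntegral.integral_congr fun x hx => h (Or.inl ?_)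
        rw [Set.uIcc_of_le hab] at hx
        simpa using hx
    · congr 1
      refine intervalIntegral.integral_congr fun x hx => h (Or.inr ?_)
      rw [Set.uIcc_of_le hcd] at hx
      simpa using hx
  · congr 1
    refine intervalIntegral.integral_congr fun x hx => h (Or.inr ?_)
    rw [Set.uIcc_of_le hcd] at hx
    simpa using hx

-- The factor k turns the plane so that the segment, seen from w, misses the cut of the principal
-- logarithm; it drops out of the derivative.
open Complex in
theorem integral_inv_horizontal {a b y : ℝ} {w k : ℂ} 
    (hk : ∀ x ∈ Set.uIcc a b, k * (x + y * I - w) ∈ slitPlane) (hk0 : k ≠ 0) :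
    ∫ x : ℝ in a..b, (x + y * I - w)⁻¹ = log (k * (b + y * I - w)) - log (k * (a + y * I - w)) := by
  have hne : ∀ x ∈ Set.uIcc a b, (x + y * I - w) ≠ 0 := fun x hx h => by
    have := hk x hx
    simp [h] at this
  refine intervalIntegral.integral_eq_sub_of_hasDerivAt (f := fun x : ℝ => log (k * (x + y * I - w)))
    (fun x hx => ?_) ?_
  · have h1 : HasDerivAt (fun x : ℝ => k * ((x : ℂ) + y * I - w)) (k * 1) x :=
      (((hasDerivAt_id x).ofReal_comp.add_const _).sub_const _).const_mul k
    refine (h1.clog_real (hk x hx)).congr_deriv ?_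
    rw [mul_div_mul_left _ _ hk0]
    simp [div_eq_mul_inv]
  · apply ContinuousOn.intervalIntegrable
    exact ContinuousOn.inv₀ (by fun_prop) hne

open Complex in
theorem integral_inv_vertical {a c d : ℝ} {w k : ℂ} 
    (hk : ∀ y ∈ Set.uIcc c d, k * (a + y * I - w) ∈ slitPlane) (hk0 : k ≠ 0) :
    I * ∫ y : ℝ in c..d, (a + y * I - w)⁻¹ = log (k * (a + d * I - w)) - log (k * (a + c * I - w)) := by
  have hne : ∀ y ∈ Set.uIcc c d, (a + y * I - w) ≠ 0 := fun x hx h => by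
    have := hk x hx
    simp [h] at this
  rw [← intervalIntegral.integral_const_mul]
  refine intervalIntegral.integral_eq_sub_of_hasDerivAt (f := fun y : ℝ => log (k * (a + y * I - w)))
    (fun x hx => ?_) ?_
  · have h1 : HasDerivAt (fun x : ℝ => k * ((a : ℂ) + x * I - w)) (k * (1 * I)) x :=
      ((((hasDerivAt_id x).ofReal_comp.mul_const I).const_add _).sub_const _).const_mul k
    refine (h1.clog_real (hk x hx)).congr_deriv ?_
    rw [mul_div_mul_left _ _ hk0]
    simp [div_eq_mul_inv]
  · apply ContinuousOn.intervalIntegrable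
    exact continuousOn_const.mul (ContinuousOn.inv₀ (by fun_prop) hne)

-- Only the left side crosses the cut, and there log(-·) serves as primitive. It differs from log by
-- -πi at the upper left corner and by +πi at the lower left one. All else telescopes, leaving 2πi.
open Complex in
theorem rectIntegral_inv_sub {a b c d : ℝ} {w : ℂ} (hwr : w.re ∈ Set.Ioo a b)
    (hwi : w.im ∈ Set.Ioo c d) :
    rectIntegral (fun z => (z - w)⁻¹) a b c d = 2 * Real.pi * I := by
  obtain ⟨ha, hb⟩ := hwr
  obtain ⟨hc, hd⟩ := hwi
  simp only [rectIntegral]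
  rw [integral_inv_horizontal (k := 1) (fun x _ => ?_) one_ne_zero,
    integral_inv_horizontal (k := 1) (fun x _ => ?_) one_ne_zero,
    integral_inv_vertical (k := 1) (fun x _ => ?_) one_ne_zero,
    integral_inv_vertical (k := -1) (fun x _ => ?_) (by simp)]
  rotate_left
  · left; simpa using ha
  · left; simpa using hb
  · right; simpa using (sub_pos.2 hd).ne'
  · right; simpa using (sub_neg.2 hc).ne
  have h1 : log (-1 * (a + d * I - w)) = log (a + d * I - w) - Real.pi * I := by
    apply Complex.ext
    · simp [log_re, ← norm_neg (a + d * I - w)]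
    · rw [neg_one_mul, log_im, arg_neg_eq_arg_sub_pi_of_im_pos (by simpa using hd)]
      simp [log_im]
  have h2 : log (-1 * (a + c * I - w)) = log (a + c * I - w) + Real.pi * I := by
    apply Complex.ext
    · simp [log_re, ← norm_neg (a + c * I - w)]
    · rw [neg_one_mul, log_im, arg_neg_eq_arg_add_pi_of_im_neg (by simpa using hc)]
      simp [log_im]
  rw [h1, h2]
  simp only [one_mul]
  ring

/-- The **argument principle** on a rectangle. -/
theorem rectIntegral_logDeriv {f : ℂ → ℂ} {a b c d : ℝ} (hab : a ≤ b) (hcd : c ≤ d)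
    (hf : AnalyticOnNhd ℂ f (Set.Icc a b ×ℂ Set.Icc c d))
    (ht : ∀ ρ ∈ Set.Icc a b ×ℂ Set.Icc c d, analyticOrderAt f ρ ≠ ⊤)
    (hb : ∀ z ∈ rectBoundary a b c d, f z ≠ 0) (Z : Finset ℂ)
    (hZ : ∀ ρ, ρ ∈ Z ↔ ρ ∈ Set.Icc a b ×ℂ Set.Icc c d ∧ f ρ = 0) :
    rectIntegral (logDeriv f) a b c d
      = 2 * Real.pi * Complex.I * ∑ ρ ∈ Z, (analyticOrderNatAt f ρ : ℂ) := by
  obtain ⟨g, hg, hfg, hg0⟩ := exists_eq_prod_sub_pow_mul hf Z (fun ρ h => ((hZ ρ).1 h).1)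
    (fun ρ h => ht ρ ((hZ ρ).1 h).1)
  have hsub : rectBoundary a b c d ⊆ Set.Icc a b ×ℂ Set.Icc c d := by
    rintro z (⟨h, h' | h'⟩ | ⟨h, h' | h'⟩) <;> simp only [Complex.mem_reProdIm, h', h, true_and] <;>
      simp [hab, hcd]
  have hgne : ∀ z ∈ Set.Icc a b ×ℂ Set.Icc c d, g z ≠ 0 := fun z hz h =>
    hg0 z ((hZ z).2 ⟨hz, by rw [hfg, h, mul_zero]⟩) h
  have hZb : ∀ z ∈ rectBoundary a b c d, ∀ ρ ∈ Z, z ≠ ρ := fun z hz ρ hρ h =>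
    hb z hz (h ▸ ((hZ ρ).1 hρ).2)
  have hgd : DifferentiableOn ℂ (logDeriv g) (Set.Icc a b ×ℂ Set.Icc c d) := fun z hz =>
    ((hg z hz).deriv.div (hg z hz) (hgne z hz)).differentiableAt.differentiableWithinAt
  have hcont : ∀ ρ ∈ Z, ContinuousOn (fun z => (z - ρ)⁻¹) (rectBoundary a b c d) := fun ρ hρ =>
    ContinuousOn.inv₀ (by fun_prop) fun z hz => sub_ne_zero.2 (hZb z hz ρ hρ)
  have hcont' : ∀ ρ ∈ Z, ContinuousOn (fun z => (analyticOrderNatAt f ρ : ℂ) * (z - ρ)⁻¹)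
      (rectBoundary a b c d) := fun ρ hρ => continuousOn_const.mul (hcont ρ hρ)
  rw [rectIntegral_congr hab hcd (g := fun z =>
    (∑ ρ ∈ Z, (analyticOrderNatAt f ρ : ℂ) * (z - ρ)⁻¹) + logDeriv g z), rectIntegral_add hab hcd
      (continuousOn_finsetSum _ hcont') (hgd.continuousOn.mono hsub),
    rectIntegral_finset_sum hab hcd hcont', rectIntegral_eq_zero hab hcd hgd, add_zero,
    Finset.mul_sum]
  · refine Finset.sum_congr rfl fun ρ hρ => ?_
    rw [rectIntegral_const_mul, rectIntegral_inv_sub, mul_comm]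
    · have h1 := ((hZ ρ).1 hρ).1
      rw [Complex.mem_reProdIm] at h1
      refine ⟨lt_of_le_of_ne h1.1.1 fun h => hb ρ (Or.inr ⟨h1.2, Or.inl h.symm⟩) ((hZ ρ).1 hρ).2,
        lt_of_le_of_ne h1.1.2 fun h => hb ρ (Or.inr ⟨h1.2, Or.inr h⟩) ((hZ ρ).1 hρ).2⟩
    · have h1 := ((hZ ρ).1 hρ).1
      rw [Complex.mem_reProdIm] at h1
      refine ⟨lt_of_le_of_ne h1.2.1 fun h => hb ρ (Or.inl ⟨h1.1, Or.inl h.symm⟩) ((hZ ρ).1 hρ).2,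
        lt_of_le_of_ne h1.2.2 fun h => hb ρ (Or.inl ⟨h1.1, Or.inr h⟩) ((hZ ρ).1 hρ).2⟩
  · intro z hz
    simp only
    rw [logDeriv_eq_sum_add hfg (hb z hz) (hg z (hsub hz)) (hZb z hz)]
    simp [div_eq_mul_inv]

/-! ### Discs: Borel–Carathéodory, Jensen and Landau's lemma. -/

-- L is the primitive of g'/g vanishing at c: the derivative of g · exp(-L) is zero. This logarithm
-- is what Borel–Carathéodory is applied to.
open Metric in
theorem exists_exp_eq_of_ne_zero {g : ℂ → ℂ} {c : ℂ} {R : ℝ} (hR : 0 < R)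
    (hg : DifferentiableOn ℂ g (ball c R)) (hg0 : ∀ z ∈ ball c R, g z ≠ 0) :
    ∃ L : ℂ → ℂ, L c = 0 ∧ (∀ z ∈ ball c R, HasDerivAt L (logDeriv g z) z) ∧
      ∀ z ∈ ball c R, g z = g c * Complex.exp (L z) := by
  have hd : DifferentiableOn ℂ (logDeriv g) (ball c R) :=
    (hg.deriv isOpen_ball).div hg hg0
  obtain ⟨L, hLc, hL⟩ := hd.isExactOn_ball.with_val_at c 0
  refine ⟨L, hLc, hL, fun z hz => ?_⟩
  have hder : ∀ w ∈ ball c R, HasDerivAt (fun w => g w * Complex.exp (-L w)) 0 w := fun w hw => by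
    have h1 := (hg.differentiableAt (isOpen_ball.mem_nhds hw)).hasDerivAt
    refine (h1.mul (hL w hw).neg.cexp).congr_deriv ?_
    have := hg0 w hw
    simp only [logDeriv_apply]
    field_simp
    ring
  have hc := isOpen_ball.is_const_of_deriv_eq_zero (convex_ball c R).isPreconnected
    (fun w hw => (hder w hw).differentiableAt.differentiableWithinAt)
    (fun w hw => (hder w hw).deriv) hz (mem_ball_self hR)
  simp only [hLc, neg_zero, Complex.exp_zero, mul_one] at hc
  rw [← hc, mul_assoc, ← Complex.exp_add]
  simp

-- The growth bound says that the real part of log(g / g(c)) is at most K. Borel–Carathéodory turns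
-- this into a bound for its modulus, and Cauchy's estimate on the circle of radius δ = (R - r)/2
-- about z bounds its derivative.
open Metric in
theorem norm_logDeriv_le_of_norm_le {g : ℂ → ℂ} {c : ℂ} {r R K : ℝ} (hr : 0 < r) (hrR : r < R)
    (hK : 0 < K) (hg : DifferentiableOn ℂ g (ball c R)) (hg0 : ∀ z ∈ ball c R, g z ≠ 0)
    (hgK : ∀ z ∈ ball c R, ‖g z‖ ≤ Real.exp K * ‖g c‖) {z : ℂ} (hz : z ∈ closedBall c r) :
    ‖logDeriv g z‖ ≤ 4 * (r + R) / (R - r) ^ 2 * K := by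
  have hR : 0 < R := hr.trans hrR
  obtain ⟨L, hLc, hL, hgL⟩ := exists_exp_eq_of_ne_zero hR hg hg0
  have hgc : 0 < ‖g c‖ := norm_pos_iff.2 (hg0 c (mem_ball_self hR))
  have hre : ∀ w ∈ ball c R, (L w).re ≤ K := fun w hw => by
    have := hgK w hw
    rw [hgL w hw, norm_mul, Complex.norm_exp, mul_comm] at this
    exact Real.exp_le_exp.1 (le_of_mul_le_mul_right this hgc)
  have hmaps : ∀ w ∈ ball (0 : ℂ) R, c + w ∈ ball c R := fun w hw => by simpa using hw
  have hLd : DifferentiableOn ℂ (fun w => L (c + w)) (ball 0 R) := fun w hw => by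
    have := (hL _ (hmaps w hw)).differentiableAt
    exact (this.fun_comp' w (by fun_prop)).differentiableWithinAt
  set δ := (R - r) / 2 with hδ
  have hδ0 : 0 < δ := by simp only [hδ]; linarith
  have hbound : ∀ w ∈ sphere z δ, ‖L w‖ ≤ 2 * K * (r + δ) / δ := fun w hw => by
    have hwr : ‖w - c‖ ≤ r + δ := by
      have h1 : ‖w - z‖ = δ := by simpa [dist_eq_norm] using hw
      have h2 : ‖z - c‖ ≤ r := by simpa [dist_eq_norm] using hz
      calc ‖w - c‖ = ‖(w - z) + (z - c)‖ := by congr 1; ring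
        _ ≤ ‖w - z‖ + ‖z - c‖ := norm_add_le _ _
        _ ≤ _ := by linarith
    have hwR : w - c ∈ ball (0 : ℂ) R := by simp only [mem_ball, dist_zero_right]; linarith
    have h := Complex.borelCaratheodory_zero hK hLd (fun x hx => hre _ (hmaps x hx)) hR hwR
      (by simpa using hLc)
    simp only [add_sub_cancel] at h
    refine h.trans ?_
    have : δ ≤ R - ‖w - c‖ := by linarith
    gcongr
  have hball : closedBall z δ ⊆ ball c R := fun w hw => by
    simp only [mem_closedBall, mem_ball] at *
    linarith [dist_triangle w z c]
  have hz' : z ∈ ball c R := hball (mem_closedBall_self hδ0.le)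
  have hdiff : DiffContOnCl ℂ L (ball z δ) := by
    apply DifferentiableOn.diffContOnCl
    rw [closure_ball _ hδ0.ne']
    exact fun w hw => (hL w (hball hw)).differentiableAt.differentiableWithinAt
  have := Complex.norm_deriv_le_of_forall_mem_sphere_norm_le hδ0 hdiff hbound
  rw [(hL z hz').deriv] at this
  refine this.trans (le_of_eq ?_)
  have : R - r ≠ 0 := by linarith
  simp only [hδ]
  field_simp
  ring

open Metric in
/-- **Jensen's inequality** for the number of zeros, with zeros listed in a `Finset`. -/
theorem sum_analyticOrderNatAt_le {f : ℂ → ℂ} {c : ℂ} {r R M : ℝ} (hr : 0 < r) (hrR : r < R)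
    (hM : 0 ≤ M) (hf : AnalyticOnNhd ℂ f (closedBall c R)) (hfc : f c ≠ 0)
    (hfM : ∀ z ∈ closedBall c R, ‖f z‖ ≤ Real.exp M * ‖f c‖) (Z : Finset ℂ)
    (hZ : ∀ ρ ∈ Z, ρ ∈ closedBall c r) :
    ∑ ρ ∈ Z, (analyticOrderNatAt f ρ : ℝ) ≤ M / Real.log (R / r) := by
  have hR : 0 < R := hr.trans hrR
  set F : ℂ → ℂ := (fun _ => (f c)⁻¹) * f with hF
  have hc0 : (f c)⁻¹ ≠ 0 := inv_ne_zero hfc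
  have hFa : AnalyticOnNhd ℂ F (closedBall c R) := analyticOnNhd_const.mul hf
  have hFc : F c = 1 := by simp [hF, hfc]
  have hFM : ∀ z ∈ sphere c |R|, ‖F z‖ ≤ Real.exp M := fun z hz => by
    rw [abs_of_pos hR] at hz
    have := hfM z (sphere_subset_closedBall hz)
    simp only [hF, Pi.mul_apply, norm_mul, norm_inv]
    rwa [inv_mul_le_iff₀ (norm_pos_iff.2 hfc), mul_comm]
  have hord : ∀ u ∈ closedBall c R, analyticOrderAt F u = analyticOrderAt f u := fun u hu => by
    rw [hF, analyticOrderAt_mul analyticAt_const (hf u hu),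
      analyticAt_const.analyticOrderAt_eq_zero.2 hc0, zero_add]
  have key := AnalyticOnNhd.sum_divisor_le (c := c) (r := r) (R := R) (M := Real.exp M) (f := F)
    (by simpa using hr.ne') (by rwa [abs_of_pos hr, abs_of_pos hR]) (Real.one_le_exp hM)
    (by rwa [abs_of_pos hR]) (by simp [hFc]) hFM
  rw [hFc, norm_one, div_one, Real.log_exp, abs_of_pos hr] at key
  refine le_trans ?_ key
  have hFa' : AnalyticOnNhd ℂ F (closedBall c r) := hFa.mono (closedBall_subset_closedBall hrR.le)
  have hfin := (MeromorphicOn.divisor F (closedBall c r)).finiteSupport (isCompact_closedBall c r)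
  rw [finsum_eq_sum_of_support_subset (s := hfin.toFinset ∪ Z) _ (by
    intro x hx; simp only [Finset.coe_union, Set.mem_union]; left; simpa using hx)]
  push_cast
  refine le_trans ?_ (Finset.sum_le_sum_of_subset_of_nonneg Finset.subset_union_right ?_)
  · refine Finset.sum_le_sum fun ρ hρ => ?_
    rw [MeromorphicOn.AnalyticOnNhd.divisor_apply hFa' (hZ ρ hρ),
      hord ρ (closedBall_subset_closedBall hrR.le (hZ ρ hρ)), analyticOrderNatAt]
    cases analyticOrderAt f ρ <;> simp
  · intro i _ _
    exact_mod_cast MeromorphicOn.AnalyticOnNhd.divisor_nonneg hFa' i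

open Metric in
/-- Landau's lemma: near the centre of a disc, the logarithmic derivative of `f` is given by the
zeros of `f` in the disc, up to an error controlled by the growth of `f`. -/
theorem exists_norm_logDeriv_sub_sum_le {r r₁ R : ℝ} (hr : 0 < r) (hr₁ : r < r₁) (hR : r₁ < R) :
    ∃ C > 0, ∀ (f : ℂ → ℂ) (c : ℂ) (M : ℝ) (Z : Finset ℂ), 0 < M →
      AnalyticOnNhd ℂ f (closedBall c R) → f c ≠ 0 →
      (∀ z ∈ closedBall c R, ‖f z‖ ≤ Real.exp M * ‖f c‖) →
      (∀ ρ, ρ ∈ Z ↔ ρ ∈ closedBall c r₁ ∧ f ρ = 0) →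
      (∑ ρ ∈ Z, (analyticOrderNatAt f ρ : ℝ) ≤ C * M) ∧
      ∀ z ∈ closedBall c r, f z ≠ 0 →
        ‖logDeriv f z - ∑ ρ ∈ Z, (analyticOrderNatAt f ρ : ℂ) / (z - ρ)‖ ≤ C * M := by
  have hr₁0 : 0 < r₁ := hr.trans hr₁
  have hR0 : 0 < R := hr₁0.trans hR
  have hlog : 0 < Real.log (R / r₁) := Real.log_pos ((one_lt_div hr₁0).2 hR)
  set A := (Real.log (R / r₁))⁻¹ with hA
  have hA0 : 0 < A := inv_pos.2 hlog
  set B := |Real.log (r₁ / (R - r₁))| with hB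
  have hB0 : 0 ≤ B := abs_nonneg _
  set D := 4 * (r + r₁) / (r₁ - r) ^ 2 with hD
  have hD0 : 0 < D := by
    have : 0 < r₁ - r := by linarith
    positivity
  -- A is the constant of Jensen's inequality, (1 + A B) M bounds the logarithmic growth of the
  -- zero-free factor g, and D is the Borel–Carathéodory factor for the radii r < r₁.
  refine ⟨A + D * (1 + A * B), by positivity, fun f c M Z hM hf hfc hfM hZ => ?_⟩
  have hZr : ∀ ρ ∈ Z, ρ ∈ closedBall c r₁ := fun ρ h => ((hZ ρ).1 h).1
  have hcount := sum_analyticOrderNatAt_le hr₁0 hR hM.le hf hfc hfM Z hZr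
  rw [div_eq_mul_inv, ← hA, mul_comm] at hcount
  refine ⟨hcount.trans (by gcongr; have : 0 ≤ D * (1 + A * B) := by positivity
                           linarith), fun z hz hfz => ?_⟩
  have hcR : c ∈ closedBall c R := mem_closedBall_self hR0.le
  have htop : ∀ ρ ∈ Z, analyticOrderAt f ρ ≠ ⊤ := fun ρ h =>
    hf.analyticOrderAt_ne_top_of_isPreconnected (convex_closedBall c R).isPreconnected hcR
      (closedBall_subset_closedBall hR.le (hZr ρ h)) (by
        rw [(hf c hcR).analyticOrderAt_eq_zero.2 hfc]; simp)
  obtain ⟨g, hg, hfg, hgZ⟩ := exists_eq_prod_sub_pow_mul hf Z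
    (fun ρ h => closedBall_subset_closedBall hR.le (hZr ρ h)) htop
  have hg0 : ∀ w ∈ closedBall c r₁, g w ≠ 0 := fun w hw h =>
    hgZ w ((hZ w).2 ⟨hw, by rw [hfg, h, mul_zero]⟩) h
  have hgc : 0 < ‖g c‖ := norm_pos_iff.2 (hg0 c (mem_closedBall_self hr₁0.le))
  set N := ∑ ρ ∈ Z, analyticOrderNatAt f ρ with hN
  have hNle : (N : ℝ) ≤ A * M := by rw [hN]; push_cast; exact hcount
  have hq : 0 < R - r₁ := by linarith
  have hK : 0 < (1 + A * B) * M := by positivity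
  have hfc_le : ‖f c‖ ≤ r₁ ^ N * ‖g c‖ := by
    rw [hfg c, norm_mul, norm_prod, hN, ← Finset.prod_pow_eq_pow_sum]
    gcongr with ρ hρ
    rw [norm_pow]
    gcongr
    simpa [dist_eq_norm, norm_sub_rev] using hZr ρ hρ
  -- On the outer circle each factor is at least R - r₁, and at the centre at most r₁. Removing the
  -- N zeros thus costs (r₁ / (R - r₁)) ^ N, which is exp(O(M)) because N ≤ A M. The maximum
  -- principle carries the bound inside.
  have hsph : ∀ w ∈ sphere c R, ‖g w‖ ≤ Real.exp ((1 + A * B) * M) * ‖g c‖ := fun w hw => by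
    have h1 : (R - r₁) ^ N * ‖g w‖ ≤ ‖f w‖ := by
      rw [hfg w, norm_mul, norm_prod, hN, ← Finset.prod_pow_eq_pow_sum]
      gcongr with ρ hρ
      rw [norm_pow]
      gcongr
      have h2 := hZr ρ hρ
      rw [mem_closedBall, dist_eq_norm] at h2
      rw [mem_sphere, dist_eq_norm] at hw
      have := norm_sub_norm_le (w - c) (ρ - c)
      rw [show w - c - (ρ - c) = w - ρ by ring] at this
      linarith
    have h2 : (R - r₁) ^ N * ‖g w‖ ≤ Real.exp M * (r₁ ^ N * ‖g c‖) :=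
      h1.trans ((hfM w (sphere_subset_closedBall hw)).trans (by gcongr))
    have h3 : ‖g w‖ ≤ Real.exp M * (r₁ / (R - r₁)) ^ N * ‖g c‖ := by
      rw [div_pow, ← mul_div_assoc, div_mul_eq_mul_div, le_div_iff₀ (by positivity)]
      linarith
    refine h3.trans ?_
    gcongr
    have h4 : (r₁ / (R - r₁)) ^ N = Real.exp (N * Real.log (r₁ / (R - r₁))) := by
      rw [mul_comm, Real.exp_mul, Real.exp_log (by positivity), Real.rpow_natCast]
    rw [h4, ← Real.exp_add]
    apply Real.exp_le_exp.2
    have h5 : N * Real.log (r₁ / (R - r₁)) ≤ (A * M) * B := by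
      calc N * Real.log (r₁ / (R - r₁)) ≤ N * B := by gcongr; exact le_abs_self _
        _ ≤ _ := by gcongr
    linarith
  have hgd : DifferentiableOn ℂ g (closedBall c R) := hg.differentiableOn
  have hball : ∀ w ∈ closedBall c R, ‖g w‖ ≤ Real.exp ((1 + A * B) * M) * ‖g c‖ := fun w hw => by
    refine Complex.norm_le_of_forall_mem_frontier_norm_le (U := ball c R) isBounded_ball ?_ ?_ ?_
    · apply DifferentiableOn.diffContOnCl
      rwa [closure_ball _ hR0.ne']
    · intro w hw
      rw [frontier_ball _ hR0.ne'] at hw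
      exact hsph w hw
    · rwa [closure_ball _ hR0.ne']
  have hsub : ball c r₁ ⊆ closedBall c R :=
    ball_subset_closedBall.trans (closedBall_subset_closedBall hR.le)
  have hlg := norm_logDeriv_le_of_norm_le hr hr₁ hK (hgd.mono hsub)
    (fun w hw => hg0 w (ball_subset_closedBall hw)) (fun w hw => hball w (hsub hw)) hz
  have hzR : z ∈ closedBall c R := closedBall_subset_closedBall (hr₁.trans hR).le hz
  rw [logDeriv_eq_sum_add hfg hfz (hg z hzR) (fun ρ hρ h => hfz (h ▸ ((hZ ρ).1 hρ).2)),
    add_sub_cancel_left]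
  refine hlg.trans ?_
  rw [← hD]
  have : 0 ≤ A * M := by positivity
  linarith

/-! ### Bounds for ζ and ζ'/ζ in right half-planes. -/

-- The transform is the integral of {x} x^(-s-1) over x > 1, through which ζ continues to Re s > 0;
-- 0 ≤ {x} < 1 gives the bound.
open MeasureTheory Complex in
theorem norm_mellin_fract_le {s : ℂ} (hs : 0 < s.re) :
    ‖mellin ((Set.Ioi (1 : ℝ)).indicator fun x => ((Int.fract x : ℝ) : ℂ)) (-s)‖ ≤ 1 / s.re := by
  have h0 : ∫ x in Set.Ioi (1 : ℝ), x ^ (-s.re - 1) = 1 / s.re := by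
    rw [integral_Ioi_rpow_of_lt (by linarith) one_pos]
    simp only [Real.one_rpow]
    rw [sub_add_cancel, neg_div_neg_eq]
  rw [← h0, ← integral_indicator measurableSet_Ioi, mellin, ← integral_indicator measurableSet_Ioi]
  refine norm_integral_le_of_norm_le ?_ ?_
  · exact (integrableOn_Ioi_rpow_of_lt (by linarith) one_pos).integrable_indicator measurableSet_Ioi
  · refine Eventually.of_forall fun x => ?_
    by_cases hx : 1 < x
    · have hx0 : 0 < x := one_pos.trans hx
      simp only [Set.indicator, Set.mem_Ioi, hx, hx0, if_true, smul_eq_mul, norm_mul]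
      rw [norm_cpow_eq_rpow_re_of_pos hx0, norm_real, Real.norm_of_nonneg (Int.fract_nonneg _)]
      simp only [sub_re, neg_re, one_re]
      exact mul_le_of_le_one_right (by positivity) (Int.fract_lt_one x).le
    · simp [Set.indicator, hx]

open MeasureTheory Complex in
theorem differentiableAt_mellin_fract {s : ℂ} (hs : 0 < s.re) :
    DifferentiableAt ℂ
      (mellin ((Set.Ioi (1 : ℝ)).indicator fun x => ((Int.fract x : ℝ) : ℂ))) (-s) := by
  have hb : ∀ x, ‖(Set.Ioi (1 : ℝ)).indicator (fun x => ((Int.fract x : ℝ) : ℂ)) x‖ ≤ 1 := fun x => by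
    by_cases hx : 1 < x
    · simp only [Set.indicator, Set.mem_Ioi, hx, if_true]
      rw [norm_real, Real.norm_of_nonneg (Int.fract_nonneg _)]
      exact (Int.fract_lt_one x).le
    · simp [Set.indicator, hx]
  have hm : Measurable ((Set.Ioi (1 : ℝ)).indicator fun x => ((Int.fract x : ℝ) : ℂ)) :=
    (measurable_fract.complex_ofReal).indicator measurableSet_Ioi
  refine mellin_differentiableAt_of_isBigO_rpow (a := 0) (b := -s.re - 1) ?_ ?_ (by simpa using hs)
    ?_ (by simp)
  · refine LocallyIntegrable.locallyIntegrableOn ?_ _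
    refine (locallyIntegrable_const (1 : ℝ)).mono hm.aestronglyMeasurable
      (Eventually.of_forall fun x => ?_)
    simpa using hb x
  · refine IsBigO.of_bound 1 (Eventually.of_forall fun x => ?_)
    simpa using hb x
  · refine IsBigO.of_bound 1 ?_
    filter_upwards [Ioo_mem_nhdsGT (zero_lt_one' ℝ)] with x hx
    rw [Set.indicator_of_notMem (by simpa using hx.2.le)]
    simp only [norm_zero]
    positivity

-- Partial summation gives s times the integral of ⌊t⌋ t^(-s-1); then ⌊t⌋ = t - {t}.
open MeasureTheory Complex in
theorem riemannZeta_eq_sub_mellin_fract {s : ℂ} (hs : 1 < s.re) :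
    riemannZeta s = s * ((s - 1)⁻¹ -
      mellin ((Set.Ioi (1 : ℝ)).indicator fun x => ((Int.fract x : ℝ) : ℂ)) (-s)) := by
  have hs0 : 0 < s.re := by linarith
  rw [← LSeries_one_eq_riemannZeta hs, LSeries_eq_mul_integral' 1 zero_le_one hs]
  · congr 1
    have h1 : ∫ t in Set.Ioi (1 : ℝ), (t : ℂ) ^ (-s) = (s - 1)⁻¹ := by
      rw [integral_Ioi_cpow_of_lt (by simpa using hs) one_pos, ofReal_one, one_cpow,
        show -s + 1 = -(s - 1) by ring]
      rw [neg_div_neg_eq, one_div]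
    have h2 : mellin ((Set.Ioi (1 : ℝ)).indicator fun x => ((Int.fract x : ℝ) : ℂ)) (-s)
        = ∫ t in Set.Ioi (1 : ℝ), (t : ℂ) ^ (-s - 1) * (Int.fract t : ℝ) := by
      rw [mellin, ← integral_indicator measurableSet_Ioi, ← integral_indicator measurableSet_Ioi]
      congr 1
      ext x
      by_cases hx : 1 < x
      · have hx0 : 0 < x := one_pos.trans hx
        simp [Set.indicator, hx, hx0]
      · simp [Set.indicator, hx]
    rw [h2, ← h1, ← integral_sub]
    · refine setIntegral_congr_fun measurableSet_Ioi fun t ht => ?_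
      have ht0 : (0 : ℝ) < t := one_pos.trans ht
      have htc : (t : ℂ) ≠ 0 := by exact_mod_cast ht0.ne'
      have h3 : ((⌊t⌋₊ : ℝ) : ℂ) = t - (Int.fract t : ℝ) := by
        rw [← ofReal_sub]
        congr 1
        rw [Int.self_sub_fract, natCast_floor_eq_intCast_floor ht0.le]
      simp only [Pi.one_apply, Finset.sum_const, Nat.card_Icc, add_tsub_cancel_right, nsmul_eq_mul,
        mul_one]
      rw [← ofReal_natCast, h3, sub_mul, show -(s + 1) = -s - 1 by ring, cpow_sub _ _ htc, cpow_one]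
      field_simp
    · exact integrableOn_Ioi_cpow_of_lt (by simpa using hs) one_pos
    · have h4 : IntegrableOn (fun t : ℝ => (t : ℂ) ^ (-s - 1)) (Set.Ioi 1) :=
        integrableOn_Ioi_cpow_of_lt (by simp only [sub_re, neg_re, one_re]; linarith) one_pos
      refine h4.mul_bdd (c := 1) ?_ ?_
      · exact measurable_fract.complex_ofReal.aestronglyMeasurable
      · refine Eventually.of_forall fun x => ?_
        rw [norm_real, Real.norm_of_nonneg (Int.fract_nonneg _)]
        exact (Int.fract_lt_one x).le
  · refine IsBigO.of_bound 1 (Eventually.of_forall fun n => ?_)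
    simp

-- The formula with {x} is continued from Re s > 1 to Re s > 0 by the identity theorem. It is first
-- multiplied by s - 1, so that both sides are analytic on the whole half-plane.
open Complex in
theorem norm_riemannZeta_le {s : ℂ} (hs : 0 < s.re) (hs1 : s ≠ 1) :
    ‖riemannZeta s‖ ≤ ‖s‖ * (‖s - 1‖⁻¹ + 1 / s.re) := by
  set H : ℂ → ℂ := fun s =>
    mellin ((Set.Ioi (1 : ℝ)).indicator fun x => ((Int.fract x : ℝ) : ℂ)) (-s) with hH
  have hopen : IsOpen {s : ℂ | 0 < s.re} := isOpen_lt continuous_const continuous_re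
  have hHd : DifferentiableOn ℂ H {s | 0 < s.re} := fun z hz => by
    have := differentiableAt_mellin_fract hz
    exact (this.fun_comp' z (by fun_prop)).differentiableWithinAt
  have heq : Set.EqOn riemannZeta₁ (fun s => s - s * (s - 1) * H s) {s | 0 < s.re} := by
    refine AnalyticOnNhd.eqOn_of_preconnected_of_eventuallyEq (𝕜 := ℂ) (z₀ := 2) ?_ ?_
      (convex_halfSpace_re_gt 0).isPreconnected (by simp) ?_
    · exact differentiable_riemannZeta₁.differentiableOn.analyticOnNhd hopen
    · exact DifferentiableOn.analyticOnNhd (by fun_prop) hopen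
    · have h2 : {s : ℂ | 1 < s.re} ∈ nhds (2 : ℂ) :=
        (isOpen_lt continuous_const continuous_re).mem_nhds (by simp)
      filter_upwards [h2] with z hz
      have hz1 : z ≠ 1 := fun h => by simp [h] at hz
      have hz1' : z - 1 ≠ 0 := sub_ne_zero.2 hz1
      have h3 := riemannZeta_eq_sub_mellin_fract hz
      rw [riemannZeta_eq_inv_sub_mul hz1] at h3
      have h4 := congrArg (fun w => (z - 1) * w) h3
      simp only [mul_inv_cancel_left₀ hz1'] at h4
      rw [h4]
      simp only [hH]
      field_simp
  have hs1' : s - 1 ≠ 0 := sub_ne_zero.2 hs1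
  have : riemannZeta s = s * ((s - 1)⁻¹ - H s) := by
    rw [riemannZeta_eq_inv_sub_mul hs1, heq hs]
    simp only
    field_simp
  rw [this, norm_mul, ← norm_inv]
  gcongr
  exact (norm_sub_le _ _).trans (add_le_add_right (norm_mellin_fract_le hs) _)

/-- The series without its first term is dominated by ζ(2) - 1 = π²/6 - 1 < 2/3. Hence |ζ(2 + iT)| ≥
1/3 at the centre of Landau's disc, and ζ maps Re s = 2 into the right half-plane. -/
theorem norm_riemannZeta_sub_one_le {s : ℂ} (hs : 2 ≤ s.re) :
    ‖riemannZeta s - 1‖ ≤ 2 / 3 := by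
  have hs1 : 1 < s.re := by linarith
  have h2 : HasSum (fun n : ℕ => 1 / ((n + 1 : ℝ)) ^ 2) (Real.pi ^ 2 / 6) := by
    have := hasSum_zeta_two
    rw [← hasSum_nat_add_iff' 1] at this
    simpa using this
  have h3 : HasSum (fun n : ℕ => 1 / ((n + 1 + 1 : ℝ)) ^ 2) (Real.pi ^ 2 / 6 - 1) := by
    rw [← hasSum_nat_add_iff' 1] at h2
    simpa using h2
  have hsum : Summable fun n : ℕ => 1 / ((n : ℂ) + 1) ^ s := by
    have := Complex.summable_one_div_nat_cpow.2 hs1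
    rw [← summable_nat_add_iff 1] at this
    simpa using this
  rw [zeta_eq_tsum_one_div_nat_add_one_cpow hs1, hsum.tsum_eq_zero_add]
  simp only [Nat.cast_zero, zero_add, Complex.one_cpow, div_one, add_sub_cancel_left]
  refine (tsum_of_norm_bounded h3 fun n => ?_).trans ?_
  · have : (((n + 1 : ℕ) : ℂ) + 1) = ((n + 1 + 1 : ℝ) : ℂ) := by push_cast; ring
    rw [this, norm_div, norm_one, Complex.norm_cpow_eq_rpow_re_of_pos (by positivity)]
    gcongr
    rw [← Real.rpow_natCast]
    refine Real.rpow_le_rpow_of_exponent_le ?_ (by exact_mod_cast hs)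
    have : (0 : ℝ) ≤ n := by positivity
    linarith
  · have := Real.pi_lt_d2
    have := Real.pi_pos
    nlinarith

/-- The Dirichlet series of Λ(n) is dominated termwise by its value at 3/2. -/
theorem exists_norm_logDeriv_riemannZeta_le :
    ∃ C > 0, ∀ s : ℂ, 3 / 2 ≤ s.re → ‖logDeriv riemannZeta s‖ ≤ C := by
  have h := ArithmeticFunction.LSeriesSummable_vonMangoldt (s := ((3 / 2 : ℝ) : ℂ))
    (by rw [Complex.ofReal_re]; norm_num)
  refine ⟨(∑' n, ‖LSeries.term (fun n => (ArithmeticFunction.vonMangoldt n : ℂ)) ((3 / 2 : ℝ) : ℂ) n‖) + 1,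
    by positivity, fun s hs => ?_⟩
  have hs1 : 1 < s.re := by linarith
  have h1 := ArithmeticFunction.LSeries_vonMangoldt_eq_deriv_riemannZeta_div hs1
  rw [logDeriv_apply, ← norm_neg, ← neg_div, ← h1, LSeries]
  refine (tsum_of_norm_bounded h.norm.hasSum fun n => ?_).trans (by linarith)
  exact LSeries.norm_term_le_of_re_le_re _ (by rwa [Complex.ofReal_re]) n

/-! ### The digamma function and the growth of ϑ. -/

-- In Euler's integral, (1 - x/n)^n ≤ e^(-x). The bound is independent of n, as dominated
-- convergence requires.
open MeasureTheory Complex in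
theorem norm_GammaSeq_le {s : ℂ} (hs : 0 < s.re) {n : ℕ} (hn : n ≠ 0) :
    ‖GammaSeq s n‖ ≤ Real.Gamma s.re := by
  have hn0 : (0 : ℝ) < n := by positivity
  have hint := Real.GammaIntegral_convergent hs
  rw [GammaSeq_eq_approx_Gamma_integral hs hn, Real.Gamma_eq_integral hs,
    intervalIntegral.integral_of_le hn0.le]
  refine le_trans (norm_integral_le_of_norm_le (hint.mono_set Set.Ioc_subset_Ioi_self)
    ((ae_restrict_iff' measurableSet_Ioc).2 (Eventually.of_forall fun x hx => ?_)))
    (setIntegral_mono_set hint ((ae_restrict_iff' measurableSet_Ioi).2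
      (Eventually.of_forall fun x hx => ?_)) Set.Ioc_subset_Ioi_self.eventuallyLE)
  · rw [norm_mul, norm_cpow_eq_rpow_re_of_pos hx.1, norm_real, sub_re, one_re]
    have h1 : x / n ≤ 1 := (div_le_one hn0).2 hx.2
    rw [Real.norm_of_nonneg (pow_nonneg (by linarith) _)]
    have := Real.one_sub_div_pow_le_exp_neg (n := n) hx.2
    have := hx.1
    gcongr
  · have : 0 < x := hx
    simp only [Pi.zero_apply]
    positivity

open Complex in
theorem differentiableAt_GammaSeq {s : ℂ} (hs : 0 < s.re) {n : ℕ} (hn : n ≠ 0) :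
    DifferentiableAt ℂ (fun z => GammaSeq z n) s := by
  have hn0 : (n : ℂ) ≠ 0 := by exact_mod_cast hn
  have h : ∏ j ∈ Finset.range (n + 1), (s + j) ≠ 0 := Finset.prod_ne_zero_iff.2 fun j _ h => by
    have := congrArg re h
    simp at this
    have : (0 : ℝ) ≤ j := by positivity
    linarith
  unfold GammaSeq
  refine DifferentiableAt.div (DifferentiableAt.mul ?_ (by fun_prop)) (by fun_prop) h
  exact DifferentiableAt.const_cpow differentiableAt_id (Or.inl hn0)

open Complex in
theorem logDeriv_GammaSeq {s : ℂ} (hs : 0 < s.re) {n : ℕ} (hn : n ≠ 0) :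
    logDeriv (fun z => GammaSeq z n) s
      = Real.log n - ∑ k ∈ Finset.range (n + 1), (s + k)⁻¹ := by
  have hn0 : (n : ℂ) ≠ 0 := by exact_mod_cast hn
  have hne : ∀ j ∈ Finset.range (n + 1), s + j ≠ 0 := fun j _ h => by
    have := congrArg re h
    simp at this
    have : (0 : ℝ) ≤ j := by positivity
    linarith
  have h : ∏ j ∈ Finset.range (n + 1), (s + j) ≠ 0 := Finset.prod_ne_zero_iff.2 hne
  have hd : DifferentiableAt ℂ (fun z : ℂ => (n : ℂ) ^ z) s :=
    DifferentiableAt.const_cpow differentiableAt_id (Or.inl hn0)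
  have hf : (n.factorial : ℂ) ≠ 0 := by exact_mod_cast n.factorial_ne_zero
  have hpow : (n : ℂ) ^ s ≠ 0 := by simp [cpow_eq_zero_iff, hn0]
  unfold GammaSeq
  rw [logDeriv_div (f := fun z => (n : ℂ) ^ z * n.factorial)
    (g := fun z => ∏ j ∈ Finset.range (n + 1), (z + j)) s (mul_ne_zero hpow hf) h
    (hd.mul_const _) (by fun_prop), logDeriv_mul_const (f := fun z => (n : ℂ) ^ z) s _ hf]
  congr 1
  · rw [logDeriv_apply, (hasStrictDerivAt_const_cpow (Or.inl hn0)).hasDerivAt.deriv]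
    rw [mul_div_cancel_left₀ _ hpow, ofReal_log (by positivity), ofReal_natCast]
  · have := logDeriv_prod (s := Finset.range (n + 1)) (f := fun (j : ℕ) (z : ℂ) => z + j) (x := s) hne
      (fun i _ => by fun_prop)
    rw [this]
    refine Finset.sum_congr rfl fun j _ => ?_
    simp [logDeriv_apply]

-- Cauchy's formula expresses the derivative by values on a circle, where `GammaSeq` converges
-- pointwise and is bounded uniformly in n; dominated convergence applies.
open Complex Metric in
theorem tendsto_deriv_GammaSeq {s : ℂ} (hs : 0 < s.re) :
    Tendsto (fun n => deriv (fun z => GammaSeq z n) s) atTop (nhds (deriv Gamma s)) := by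
  set r := s.re / 2 with hr
  have hr0 : 0 < r := by positivity
  have hre : ∀ z ∈ closedBall s r, z.re ∈ Set.Icc r (3 * r) := fun z hz => by
    have h1 := (abs_re_le_norm (z - s)).trans (by simpa [dist_eq_norm] using hz)
    rw [sub_re, abs_le] at h1
    constructor <;> linarith [h1.1, h1.2]
  have hpos : ∀ z ∈ closedBall s r, 0 < z.re := fun z hz => hr0.trans_le (hre z hz).1
  have hcont : ContinuousOn Real.Gamma (Set.Icc r (3 * r)) := fun x hx =>
    (Real.differentiableOn_Gamma_Ioi.differentiableAt
      (Ioi_mem_nhds (hr0.trans_le hx.1))).continuousAt.continuousWithinAt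
  obtain ⟨B, hB⟩ := isCompact_Icc.bddAbove_image hcont
  have hB' : ∀ z ∈ closedBall s r, ∀ n ≠ 0, ‖GammaSeq z n‖ ≤ B := fun z hz n hn =>
    (norm_GammaSeq_le (hpos z hz) hn).trans (hB ⟨z.re, hre z hz, rfl⟩)
  have hcauchy : ∀ f : ℂ → ℂ, DifferentiableOn ℂ f (closedBall s r) →
      deriv f s = (2 * Real.pi * I : ℂ)⁻¹ • ∮ z in C(s, r), ((z - s) ^ 2)⁻¹ • f z := fun f hf => by
    have hd : DiffContOnCl ℂ f (ball s r) := by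
      apply DifferentiableOn.diffContOnCl
      rwa [closure_ball _ hr0.ne']
    have h2 : (2 * Real.pi * I : ℂ) ≠ 0 := by simp [Real.pi_ne_zero]
    have h3 := hd.deriv_eq_smul_circleIntegral hr0
    simp only [one_div] at h3
    rw [h3, inv_smul_smul₀ h2]
  have hGd : DifferentiableOn ℂ Gamma (closedBall s r) := fun z hz =>
    (differentiableAt_Gamma z fun m h => by
      have h1 := hpos z hz
      rw [h] at h1
      simp at h1
      have : (0 : ℝ) ≤ m := by positivity
      linarith).differentiableWithinAt
  have hsd : ∀ n ≠ 0, DifferentiableOn ℂ (fun z => GammaSeq z n) (closedBall s r) := fun n hn z hz =>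
    (differentiableAt_GammaSeq (hpos z hz) hn).differentiableWithinAt
  rw [hcauchy _ hGd]
  have hev : (fun n => deriv (fun z => GammaSeq z n) s) =ᶠ[atTop] fun n =>
      (2 * Real.pi * I : ℂ)⁻¹ • ∮ z in C(s, r), ((z - s) ^ 2)⁻¹ • GammaSeq z n := by
    filter_upwards [eventually_ne_atTop 0] with n hn using hcauchy _ (hsd n hn)
  refine Tendsto.congr' hev.symm (Tendsto.const_smul ?_ _)
  simp only [circleIntegral]
  have hmem : ∀ θ, circleMap s r θ ∈ closedBall s r := circleMap_mem_closedBall s hr0.le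
  refine intervalIntegral.tendsto_integral_filter_of_dominated_convergence
    (fun _ => r * ((r ^ 2)⁻¹ * B)) ?_ ?_ ?_ ?_
  · filter_upwards [eventually_ne_atTop 0] with n hn
    have h1 : Continuous fun θ => GammaSeq (circleMap s r θ) n :=
      (hsd n hn).continuousOn.comp_continuous (continuous_circleMap s r) hmem
    have h2 : Continuous fun θ => ((circleMap s r θ - s) ^ 2)⁻¹ :=
      Continuous.inv₀ (by fun_prop) fun θ => pow_ne_zero _ (sub_ne_zero.2
        (circleMap_ne_center hr0.ne'))
    simp only [deriv_circleMap]
    exact ((((continuous_circleMap 0 r).mul continuous_const).smul (h2.smul h1))).aestronglyMeasurable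
  · filter_upwards [eventually_ne_atTop 0] with n hn
    refine Eventually.of_forall fun θ _ => ?_
    simp only [deriv_circleMap, smul_eq_mul, norm_mul, norm_inv, norm_pow, circleMap_sub_center,
      norm_circleMap_zero, norm_I, mul_one, abs_of_pos hr0]
    have := hB' _ (hmem θ) n hn
    gcongr
  · exact intervalIntegrable_const
  · refine Eventually.of_forall fun θ _ => ?_
    exact ((GammaSeq_tendsto_Gamma _).const_smul _).const_smul _

-- Gauss's limit for the digamma function. A lower bound for its real part is all that is needed of
-- Γ, so Stirling's formula is avoided.
open Complex in
theorem tendsto_logDeriv_Gamma {s : ℂ} (hs : 0 < s.re) :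
    Tendsto (fun n : ℕ => (Real.log n : ℂ) - ∑ k ∈ Finset.range (n + 1), (s + k)⁻¹) atTop
      (nhds (logDeriv Gamma s)) := by
  have h := (tendsto_deriv_GammaSeq hs).div (GammaSeq_tendsto_Gamma s) (Gamma_ne_zero_of_re_pos hs)
  refine h.congr' ?_
  filter_upwards [eventually_ne_atTop 0] with n hn
  rw [← logDeriv_GammaSeq hs hn, logDeriv_apply]
  rfl

theorem sum_Ico_inv_le_log {K n : ℕ} (hK : 1 ≤ K) (hn : K ≤ n) :
    ∑ k ∈ Finset.Ico K (n + 1), (k : ℝ)⁻¹ ≤ 1 + Real.log n - Real.log K := by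
  induction n, hn using Nat.le_induction with
  | base =>
    have : (1 : ℝ) ≤ K := by exact_mod_cast hK
    simpa using inv_le_one_of_one_le₀ this
  | succ m hm ih =>
    rw [Finset.sum_Ico_succ_top (by omega)]
    have hm0 : (0 : ℝ) < m := by exact_mod_cast (by omega : 0 < m)
    have h1 := Real.one_sub_inv_le_log_of_pos (x := ((m + 1 : ℕ) : ℝ) / m) (by positivity)
    rw [Real.log_div (by positivity) hm0.ne'] at h1
    have h2 : 1 - (((m + 1 : ℕ) : ℝ) / m)⁻¹ = ((m + 1 : ℕ) : ℝ)⁻¹ := by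
      push_cast
      field_simp
      ring
    linarith

-- In Gauss's limit, the terms k < K are small once |Im s| is large, and the terms k ≥ K are at most
-- 1/k, so they cancel log n up to log K - 1. The cut K is free: letting Im s grow and then K shows
-- that the real part tends to infinity.
open Complex in
theorem le_re_logDeriv_Gamma {s : ℂ} (hs : 0 < s.re) (hi : s.im ≠ 0) {K : ℕ} (hK : 1 ≤ K) :
    Real.log K - 1 - K * (s.re + K) / s.im ^ 2 ≤ (logDeriv Gamma s).re := by
  have h := (continuous_re.tendsto _).comp (tendsto_logDeriv_Gamma hs)
  refine ge_of_tendsto h ?_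
  filter_upwards [eventually_ge_atTop K] with n hn
  simp only [Function.comp_apply, sub_re, ofReal_re, re_sum]
  have hi2 : 0 < s.im ^ 2 := by positivity
  have hre : ∀ k : ℕ, ((s + k)⁻¹).re = (s.re + k) / ((s.re + k) ^ 2 + s.im ^ 2) := fun k => by
    rw [inv_re, normSq_apply]
    simp [sq]
  rw [Finset.range_eq_Ico, ← Finset.sum_Ico_consecutive _ (Nat.zero_le K) (by omega : K ≤ n + 1)]
  have h1 : ∑ k ∈ Finset.Ico 0 K, ((s + k)⁻¹).re ≤ K * (s.re + K) / s.im ^ 2 := by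
    have : ∑ k ∈ Finset.Ico 0 K, ((s + k)⁻¹).re ≤ ∑ k ∈ Finset.Ico 0 K, (s.re + K) / s.im ^ 2 := by
      refine Finset.sum_le_sum fun k hk => ?_
      rw [hre]
      have : (k : ℝ) ≤ K := by exact_mod_cast (Finset.mem_Ico.1 hk).2.le
      gcongr
      nlinarith [sq_nonneg (s.re + k)]
    refine this.trans (le_of_eq ?_)
    simp [mul_div_assoc]
  have h2 : ∑ k ∈ Finset.Ico K (n + 1), ((s + k)⁻¹).re ≤ 1 + Real.log n - Real.log K := by
    refine le_trans (Finset.sum_le_sum fun k hk => ?_) (sum_Ico_inv_le_log hK hn)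
    have hk0 : (0 : ℝ) < k := by exact_mod_cast (by have := (Finset.mem_Ico.1 hk).1; omega : 0 < k)
    rw [hre, div_le_iff₀ (by positivity), inv_mul_eq_div, le_div_iff₀ hk0]
    nlinarith
  linarith

open Complex in
theorem analyticOnNhd_Gammaℝ : AnalyticOnNhd ℂ Gammaℝ {s | 0 < s.re} := by
  refine DifferentiableOn.analyticOnNhd (fun s hs => ?_)
    (isOpen_lt continuous_const continuous_re)
  have := (differentiable_Gammaℝ_inv s).inv (inv_ne_zero (Gammaℝ_ne_zero_of_re_pos hs))
  refine DifferentiableAt.differentiableWithinAt ?_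
  exact this.congr_of_eventuallyEq (Eventually.of_forall fun z => by simp)

open Complex in
theorem logDeriv_Gammaℝ {s : ℂ} (hs : 0 < s.re) :
    logDeriv Gammaℝ s = -(Real.log Real.pi : ℂ) / 2 + logDeriv Gamma (s / 2) / 2 := by
  have hs2 : 0 < (s / 2).re := by simpa using hs
  have hpi : (Real.pi : ℂ) ≠ 0 := by exact_mod_cast Real.pi_ne_zero
  have hG : DifferentiableAt ℂ Gamma (s / 2) := differentiableAt_Gamma _ fun m h => by
    rw [h] at hs2
    simp at hs2
    have : (0 : ℝ) ≤ m := by positivity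
    linarith
  have hd1 : HasDerivAt (fun z : ℂ => (Real.pi : ℂ) ^ (-z / 2))
      ((Real.pi : ℂ) ^ (-s / 2) * log Real.pi * (-1 / 2)) s :=
    (((hasDerivAt_id s).neg.div_const 2).const_cpow (Or.inl hpi))
  have hp0 : (Real.pi : ℂ) ^ (-s / 2) ≠ 0 := by simp [cpow_eq_zero_iff, hpi]
  have hd2 : DifferentiableAt ℂ (fun z : ℂ => Gamma (z / 2)) s := hG.fun_comp' s (by fun_prop)
  have : Gammaℝ = fun z => (Real.pi : ℂ) ^ (-z / 2) * Gamma (z / 2) := funext Gammaℝ_def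
  rw [this, logDeriv_mul (g := fun z : ℂ => Gamma (z / 2)) s hp0 (Gamma_ne_zero_of_re_pos hs2) hd1.differentiableAt hd2]
  congr 1
  · rw [logDeriv_apply, hd1.deriv, mul_assoc, mul_div_cancel_left₀ _ hp0,
      ofReal_log Real.pi_pos.le]
    ring
  · have := logDeriv_comp (f := Gamma) (g := fun z : ℂ => z / 2) (x := s) hG (by fun_prop)
    rw [show (fun z : ℂ => Gamma (z / 2)) = Gamma ∘ fun z => z / 2 from rfl, this]
    simp [div_eq_mul_inv]

open Complex in
theorem tendsto_re_logDeriv_Gammaℝ :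
    Tendsto (fun t : ℝ => (logDeriv Gammaℝ (1 / 2 + t * I)).re) atTop atTop := by
  rw [tendsto_atTop]
  intro B
  -- Half of log K - 1, less half of the error (made ≤ 1 below) and half of log π, must still be at
  -- least B.
  obtain ⟨K, hK1, hK⟩ : ∃ K : ℕ, 1 ≤ K ∧ 2 * B + Real.log Real.pi + 2 ≤ Real.log K := by
    have := (Real.tendsto_log_atTop.comp tendsto_natCast_atTop_atTop).eventually_ge_atTop
      (2 * B + Real.log Real.pi + 2)
    exact ((eventually_ge_atTop 1).and this).exists
  have hlim : Tendsto (fun t : ℝ => (K : ℝ) * (1 / 4 + K) / (t / 2) ^ 2) atTop (nhds 0) := by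
    refine Tendsto.div_atTop tendsto_const_nhds ?_
    exact (tendsto_pow_atTop two_ne_zero).comp (tendsto_id.atTop_div_const two_pos)
  filter_upwards [hlim.eventually_le_const one_pos, eventually_gt_atTop 0] with t ht ht0
  have hs : 0 < (1 / 2 + t * I : ℂ).re := by simp
  rw [logDeriv_Gammaℝ hs]
  have hre : ((1 / 2 + t * I) / 2 : ℂ).re = 1 / 4 := by simp; norm_num
  have him : ((1 / 2 + t * I) / 2 : ℂ).im = t / 2 := by simp
  have h := le_re_logDeriv_Gamma (s := (1 / 2 + t * I) / 2) (by rw [hre]; norm_num)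
    (by rw [him]; positivity) hK1
  rw [hre, him] at h
  have h1 : (-(Real.log Real.pi : ℂ) / 2).re = -(Real.log Real.pi) / 2 := by
    rw [← ofReal_neg]; simp
  rw [add_re, h1]
  have h2 : (logDeriv Gamma ((1 / 2 + t * I) / 2) / 2).re
      = (logDeriv Gamma ((1 / 2 + t * I) / 2)).re / 2 := by simp
  rw [h2]
  linarith

open Complex in
theorem continuous_re_logDeriv_Gammaℝ :
    Continuous fun t : ℝ => (logDeriv Gammaℝ (1 / 2 + t * I)).re := by
  refine continuous_re.comp (continuous_iff_continuousAt.2 fun t => ?_)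
  have hs : 0 < (1 / 2 + t * I : ℂ).re := by simp
  have ha := analyticOnNhd_Gammaℝ _ hs
  have : ContinuousAt (logDeriv Gammaℝ) (1 / 2 + t * I) :=
    (ha.deriv.div ha (Gammaℝ_ne_zero_of_re_pos hs)).continuousAt
  exact ContinuousAt.comp (f := fun t : ℝ => (1 / 2 + t * I : ℂ)) this (by fun_prop)

theorem hasDerivAt_rsTheta (t : ℝ) :
    HasDerivAt rsTheta (logDeriv Complex.Gammaℝ (1 / 2 + t * Complex.I)).re t :=
  continuous_re_logDeriv_Gammaℝ.integral_hasStrictDerivAt 0 t |>.hasDerivAt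

theorem continuous_rsTheta : Continuous rsTheta :=
  continuous_iff_continuousAt.2 fun t => (hasDerivAt_rsTheta t).continuousAt

/-- ϑ' tends to infinity, so ϑ outgrows every linear function. This absorbs the logarithmic errors
in the proofs of N(T) → ∞ and of γ_n ≤ n. -/
theorem eventually_mul_le_rsTheta (K : ℝ) : ∀ᶠ t in atTop, K * t ≤ rsTheta t := by
  obtain ⟨T, hT⟩ := eventually_atTop.1 (tendsto_re_logDeriv_Gammaℝ.eventually_ge_atTop (K + 1))
  have hmono : MonotoneOn (fun t => rsTheta t - (K + 1) * t) (Set.Ici T) := by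
    have hd : ∀ t : ℝ, HasDerivAt (fun t => rsTheta t - (K + 1) * t)
        ((logDeriv Complex.Gammaℝ (1 / 2 + t * Complex.I)).re - (K + 1) * 1) t := fun t =>
      (hasDerivAt_rsTheta t).sub ((hasDerivAt_id t).const_mul (K + 1))
    refine monotoneOn_of_deriv_nonneg (convex_Ici T)
      (fun t _ => (hd t).continuousAt.continuousWithinAt)
      (fun t _ => (hd t).differentiableAt.differentiableWithinAt) fun t ht => ?_
    rw [interior_Ici] at ht
    rw [(hd t).deriv]
    linarith [hT t (le_of_lt ht)]
  filter_upwards [eventually_ge_atTop T, eventually_ge_atTop ((K + 1) * T - rsTheta T)] with t h1 h2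
  have := hmono (Set.mem_Ici.2 le_rfl) (Set.mem_Ici.2 h1) h1
  simp only at this
  linarith

theorem exists_strictMonoOn_rsTheta : ∃ T > 0, StrictMonoOn rsTheta (Set.Ici T) := by
  obtain ⟨T, hT⟩ := eventually_atTop.1 (tendsto_re_logDeriv_Gammaℝ.eventually_ge_atTop 1)
  refine ⟨max T 1, by positivity, strictMonoOn_of_deriv_pos (convex_Ici _)
    continuous_rsTheta.continuousOn fun t ht => ?_⟩
  rw [interior_Ici] at ht
  rw [(hasDerivAt_rsTheta t).deriv]
  linarith [hT t ((le_max_left _ _).trans (le_of_lt ht))]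

/-! ### The completed zeta function: zeros and symmetries. -/

theorem Gammaℝ_ne_zero_of_im_ne_zero {s : ℂ} (hs : s.im ≠ 0) : Complex.Gammaℝ s ≠ 0 := by
  intro h
  obtain ⟨n, hn⟩ := Complex.Gammaℝ_eq_zero_iff.1 h
  exact hs (by simp [hn])

theorem ne_zero_of_im_ne_zero {s : ℂ} (hs : s.im ≠ 0) : s ≠ 0 := fun h => hs (by simp [h])

theorem ne_one_of_im_ne_zero {s : ℂ} (hs : s.im ≠ 0) : s ≠ 1 := fun h => hs (by simp [h])

theorem completedRiemannZeta_eq_zero_iff {s : ℂ} (hs : s.im ≠ 0) :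
    completedRiemannZeta s = 0 ↔ riemannZeta s = 0 := by
  rw [riemannZeta_def_of_ne_zero (ne_zero_of_im_ne_zero hs), div_eq_zero_iff]
  simp [Gammaℝ_ne_zero_of_im_ne_zero hs]

theorem re_mem_Ioo_of_riemannZeta_eq_zero {s : ℂ} (hs : s.im ≠ 0) (h : riemannZeta s = 0) :
    s.re ∈ Set.Ioo 0 1 := by
  constructor
  · by_contra! h0
    have h1 : riemannZeta (1 - s) = 0 := by
      rw [← completedRiemannZeta_eq_zero_iff (by simpa using hs), completedRiemannZeta_one_sub,
        completedRiemannZeta_eq_zero_iff hs, h]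
    exact riemannZeta_ne_zero_of_one_le_re (by simpa using h0) h1
  · by_contra! h0
    exact riemannZeta_ne_zero_of_one_le_re h0 h

theorem analyticAt_completedRiemannZeta {s : ℂ} (hs : s.im ≠ 0) :
    AnalyticAt ℂ completedRiemannZeta s := by
  have hopen : IsOpen {z : ℂ | z.im ≠ 0} := isOpen_ne_fun Complex.continuous_im continuous_const
  have : DifferentiableOn ℂ completedRiemannZeta {z : ℂ | z.im ≠ 0} := fun z hz =>
    (differentiableAt_completedZeta (ne_zero_of_im_ne_zero hz)
      (ne_one_of_im_ne_zero hz)).differentiableWithinAt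
  exact this.analyticOnNhd hopen s hs

theorem analyticAt_riemannZeta {s : ℂ} (hs : s ≠ 1) : AnalyticAt ℂ riemannZeta s := by
  have : DifferentiableOn ℂ riemannZeta {1}ᶜ := fun z hz =>
    (differentiableAt_riemannZeta hz).differentiableWithinAt
  exact this.analyticOnNhd isOpen_compl_singleton s hs

theorem analyticOrderAt_riemannZeta_ne_top {s : ℂ} (hs : s ≠ 1) :
    analyticOrderAt riemannZeta s ≠ ⊤ := by
  have ha : AnalyticOnNhd ℂ riemannZeta {1}ᶜ := fun z hz => analyticAt_riemannZeta hz
  have h2 : riemannZeta 2 ≠ 0 := riemannZeta_ne_zero_of_one_le_re (by simp)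
  refine ha.analyticOrderAt_ne_top_of_isPreconnected (x := 2)
    (isConnected_compl_singleton_of_one_lt_rank (by simp) 1).isPreconnected (by simp) hs ?_
  rw [(ha 2 (by simp)).analyticOrderAt_eq_zero.2 h2]
  simp

theorem analyticOrderAt_completedRiemannZeta {s : ℂ} (hs : s.im ≠ 0) :
    analyticOrderAt completedRiemannZeta s = analyticOrderAt riemannZeta s := by
  have hinv : AnalyticAt ℂ (fun z => (Complex.Gammaℝ z)⁻¹) s :=
    Complex.differentiable_Gammaℝ_inv.differentiableOn.analyticOnNhd isOpen_univ s trivial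
  have heq : riemannZeta =ᶠ[nhds s] (fun z => (Complex.Gammaℝ z)⁻¹) * completedRiemannZeta := by
    filter_upwards [isOpen_ne.mem_nhds (ne_zero_of_im_ne_zero hs)] with z hz
    rw [riemannZeta_def_of_ne_zero hz, Pi.mul_apply, div_eq_inv_mul]
  rw [analyticOrderAt_congr heq, analyticOrderAt_mul hinv (analyticAt_completedRiemannZeta hs),
    hinv.analyticOrderAt_eq_zero.2 (inv_ne_zero (Gammaℝ_ne_zero_of_im_ne_zero hs)), zero_add]

theorem logDeriv_completedRiemannZeta {s : ℂ} (hs : s.im ≠ 0) (hre : 0 < s.re)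
    (h0 : riemannZeta s ≠ 0) :
    logDeriv completedRiemannZeta s = logDeriv Complex.Gammaℝ s + logDeriv riemannZeta s := by
  have heq : completedRiemannZeta =ᶠ[nhds s] fun z => Complex.Gammaℝ z * riemannZeta z := by
    have hopen : IsOpen {z : ℂ | z.im ≠ 0} := isOpen_ne_fun Complex.continuous_im continuous_const
    filter_upwards [hopen.mem_nhds hs] with z hz
    rw [riemannZeta_def_of_ne_zero (ne_zero_of_im_ne_zero hz),
      mul_div_cancel₀ _ (Gammaℝ_ne_zero_of_im_ne_zero hz)]
  rw [(logDeriv_congr_nhds heq).self_of_nhds, logDeriv_mul s (Gammaℝ_ne_zero_of_im_ne_zero hs) h0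
    (analyticOnNhd_Gammaℝ s hre).differentiableAt
    (differentiableAt_riemannZeta (ne_one_of_im_ne_zero hs))]

open ComplexConjugate in
theorem Gammaℝ_conj (s : ℂ) : Complex.Gammaℝ (conj s) = conj (Complex.Gammaℝ s) := by
  have hpi : (Real.pi : ℂ).arg ≠ Real.pi := by
    rw [Complex.arg_ofReal_of_nonneg Real.pi_pos.le]; exact Real.pi_ne_zero.symm
  rw [Complex.Gammaℝ_def, Complex.Gammaℝ_def, map_mul, ← Complex.Gamma_conj]
  have h := Complex.conj_cpow (Real.pi : ℂ) (-s / 2) hpi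
  have h2 := Complex.cpow_conj (Real.pi : ℂ) (-s / 2) hpi
  simp only [Complex.conj_ofReal, map_div₀, map_neg, map_ofNat] at h h2 ⊢
  rw [h2]

open ComplexConjugate in
theorem completedRiemannZeta_conj {s : ℂ} (hs : s.im ≠ 0) :
    completedRiemannZeta (conj s) = conj (completedRiemannZeta s) := by
  have hs' : (conj s).im ≠ 0 := by simpa using hs
  have h (z : ℂ) (hz : z.im ≠ 0) : completedRiemannZeta z = Complex.Gammaℝ z * riemannZeta z := by
    rw [riemannZeta_def_of_ne_zero (ne_zero_of_im_ne_zero hz),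
      mul_div_cancel₀ _ (Gammaℝ_ne_zero_of_im_ne_zero hz)]
  rw [h _ hs', h _ hs, Gammaℝ_conj, riemannZeta_conj, map_mul]

-- Λ(1 - s) = Λ(s) and Λ(s̄) = conj Λ(s) together give the reflection in Re s = 1/2, by which
-- contour integrals are folded onto the right half.
open ComplexConjugate in
theorem logDeriv_completedRiemannZeta_one_sub_conj {s : ℂ} (hs : s.im ≠ 0) :
    logDeriv completedRiemannZeta (1 - conj s) = -conj (logDeriv completedRiemannZeta s) := by
  have h1 : ∀ z, deriv completedRiemannZeta (1 - z) = -deriv completedRiemannZeta z := fun z => by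
    have h := deriv_comp_const_sub (f := completedRiemannZeta) 1 z
    simp only [completedRiemannZeta_one_sub] at h
    rw [h, neg_neg]
  have h2 : deriv completedRiemannZeta (conj s) = conj (deriv completedRiemannZeta s) := by
    have heq : completedRiemannZeta =ᶠ[nhds (conj s)] conj ∘ completedRiemannZeta ∘ conj := by
      have hopen : IsOpen {z : ℂ | z.im ≠ 0} :=
        isOpen_ne_fun Complex.continuous_im continuous_const
      filter_upwards [hopen.mem_nhds (show (conj s).im ≠ 0 by simpa using hs)] with z hz
      simp [completedRiemannZeta_conj hz]
    rw [heq.deriv_eq, deriv_conj_conj]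
    simp
  rw [logDeriv_apply, logDeriv_apply, h1, h2, completedRiemannZeta_one_sub,
    completedRiemannZeta_conj hs, map_div₀, neg_div]

/-! ### Counting zeros: the Riemann–von Mangoldt formula. -/

theorem finite_zeta_zeros_upTo (T : ℝ) :
    {s : ℂ | riemannZeta s = 0 ∧ 0 < s.im ∧ s.im ≤ T}.Finite := by
  refine ((isCompact_Icc.reProdIm isCompact_Icc : IsCompact
    (Set.Icc (0 : ℝ) 1 ×ℂ Set.Icc 0 T)).inter_riemannZetaZeros_finite).subset ?_
  rintro s ⟨h, h1, h2⟩
  have := re_mem_Ioo_of_riemannZeta_eq_zero h1.ne' h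
  exact ⟨⟨⟨this.1.le, this.2.le⟩, h1.le, h2⟩, h⟩

noncomputable section

/-- The zeros of `ζ` with imaginary part in `(0, T]`. -/
def zetaZerosUpTo (T : ℝ) : Finset ℂ := (finite_zeta_zeros_upTo T).toFinset

/-- The number `N(T)` of zeros of `ζ` with imaginary part in `(0, T]`, with multiplicity. -/
def zetaZeroCount (T : ℝ) : ℕ := ∑ ρ ∈ zetaZerosUpTo T, analyticOrderNatAt riemannZeta ρ

/-- The variation of the argument of `ζ` along the segment from `1/2 + iT` to `2 + iT`. -/
def zetaArgVariation (T : ℝ) : ℝ :=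
  ∫ x in (1 / 2 : ℝ)..2, (logDeriv riemannZeta (x + T * Complex.I)).im

end

theorem mem_zetaZerosUpTo {T : ℝ} {s : ℂ} :
    s ∈ zetaZerosUpTo T ↔ riemannZeta s = 0 ∧ 0 < s.im ∧ s.im ≤ T := by
  simp [zetaZerosUpTo]

theorem zetaZeroCount_mono : Monotone zetaZeroCount := fun S T h =>
  Finset.sum_le_sum_of_subset fun s hs => by
    rw [mem_zetaZerosUpTo] at *
    exact ⟨hs.1, hs.2.1, hs.2.2.trans h⟩

/-- The contour argument needs horizontal sides free of zeros; such heights exist in every interval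
because ordinates are locally finite. -/
theorem exists_mem_Ioo_not_ordinate {a b : ℝ} (ha : 0 ≤ a) (hab : a < b) :
    ∃ t ∈ Set.Ioo a b, ∀ s : ℂ, riemannZeta s = 0 → s.im ≠ t := by
  obtain ⟨t, ht, h⟩ := (Set.Ioo_infinite hab).exists_notMem_finite
    ((finite_zeta_zeros_upTo b).image Complex.im)
  exact ⟨t, ht, fun s hs hst => h ⟨s, ⟨hs, hst ▸ ha.trans_lt ht.1, hst ▸ ht.2.le⟩, hst⟩⟩

theorem differentiableAt_logDeriv_completedRiemannZeta {s : ℂ} (hs : s.im ≠ 0)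
    (h0 : riemannZeta s ≠ 0) : DifferentiableAt ℂ (logDeriv completedRiemannZeta) s :=
  ((analyticAt_completedRiemannZeta hs).deriv.div (analyticAt_completedRiemannZeta hs)
    (mt (completedRiemannZeta_eq_zero_iff hs).1 h0)).differentiableAt

theorem differentiableAt_logDeriv_riemannZeta {s : ℂ} (hs : s ≠ 1)
    (h0 : riemannZeta s ≠ 0) : DifferentiableAt ℂ (logDeriv riemannZeta) s :=
  ((analyticAt_riemannZeta hs).deriv.div (analyticAt_riemannZeta hs) h0).differentiableAt

theorem differentiableAt_logDeriv_Gammaℝ {s : ℂ} (hs : 0 < s.re) :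
    DifferentiableAt ℂ (logDeriv Complex.Gammaℝ) s :=
  ((analyticOnNhd_Gammaℝ s hs).deriv.div (analyticOnNhd_Gammaℝ s hs)
    (Complex.Gammaℝ_ne_zero_of_re_pos hs)).differentiableAt

-- The reflection x ↦ 1 - x carries [-1, 1/2] to [1/2, 2] and the integrand to minus its conjugate.
-- Real parts cancel and imaginary parts double.
open Complex ComplexConjugate in
theorem integral_logDeriv_completedRiemannZeta_horizontal {t : ℝ} (ht : 0 < t)
    (h : ∀ s : ℂ, riemannZeta s = 0 → s.im ≠ t) :
    ∫ x in (-1 : ℝ)..2, logDeriv completedRiemannZeta (x + t * I)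
      = 2 * I * (∫ x in (1 / 2 : ℝ)..2, (logDeriv completedRiemannZeta (x + t * I)).im : ℝ) := by
  have him : ∀ x : ℝ, (x + t * I : ℂ).im = t := fun x => by simp
  have hc : Continuous fun x : ℝ => logDeriv completedRiemannZeta (x + t * I) :=
    continuous_iff_continuousAt.2 fun x =>
      ContinuousAt.comp (f := fun x : ℝ => (x + t * I : ℂ))
        (differentiableAt_logDeriv_completedRiemannZeta (by rw [him]; exact ht.ne')
          (fun h0 => h _ h0 (him x))).continuousAt (by fun_prop)
  have hi : ∀ a b, IntervalIntegrable (fun x : ℝ => logDeriv completedRiemannZeta (x + t * I))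
      MeasureTheory.volume a b := fun a b => hc.intervalIntegrable a b
  rw [← intervalIntegral.integral_add_adjacent_intervals (hi (-1) (1 / 2)) (hi (1 / 2) 2)]
  have h1 : ∫ x in (-1 : ℝ)..(1 / 2), logDeriv completedRiemannZeta (x + t * I)
      = ∫ x in (1 / 2 : ℝ)..2, -conj (logDeriv completedRiemannZeta (x + t * I)) := by
    have := intervalIntegral.integral_comp_sub_left (a := 1 / 2) (b := 2)
      (fun x : ℝ => logDeriv completedRiemannZeta (x + t * I)) 1
    rw [show (1 : ℝ) - 2 = -1 by norm_num, show (1 : ℝ) - 1 / 2 = 1 / 2 by norm_num] at this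
    rw [← this]
    refine intervalIntegral.integral_congr fun x _ => ?_
    rw [← logDeriv_completedRiemannZeta_one_sub_conj (by rw [him]; exact ht.ne')]
    congr 1
    simp
    ring
  have hcc : Continuous fun x : ℝ => -conj (logDeriv completedRiemannZeta (x + t * I)) :=
    (continuous_conj.comp hc).neg
  rw [h1, ← intervalIntegral.integral_add (hcc.intervalIntegrable _ _) (hi _ _),
    ← intervalIntegral.integral_ofReal, ← intervalIntegral.integral_const_mul]
  refine intervalIntegral.integral_congr fun x _ => ?_
  apply Complex.ext
  · simp
  · simp; ring

open Complex ComplexConjugate in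
theorem integral_logDeriv_completedRiemannZeta_vertical {S T : ℝ} (hS : 0 < S) (hST : S ≤ T) :
    I * (∫ y in S..T, logDeriv completedRiemannZeta ((2 : ℝ) + y * I))
        - I * (∫ y in S..T, logDeriv completedRiemannZeta ((-1 : ℝ) + y * I))
      = 2 * I * (∫ y in S..T, (logDeriv completedRiemannZeta ((2 : ℝ) + y * I)).re : ℝ) := by
  have hc : ContinuousOn (fun y : ℝ => logDeriv completedRiemannZeta ((2 : ℝ) + y * I))
      (Set.uIcc S T) := fun y hy => by
    rw [Set.uIcc_of_le hST] at hy
    refine ContinuousAt.continuousWithinAt (ContinuousAt.comp (f := fun y : ℝ => ((2 : ℝ) + y * I : ℂ))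
        (differentiableAt_logDeriv_completedRiemannZeta ?_
          (riemannZeta_ne_zero_of_one_le_re (by simp))).continuousAt (by fun_prop))
    simpa using (hS.trans_le hy.1).ne'
  have h1 : ∫ y in S..T, logDeriv completedRiemannZeta ((-1 : ℝ) + y * I)
      = ∫ y in S..T, -conj (logDeriv completedRiemannZeta ((2 : ℝ) + y * I)) := by
    refine intervalIntegral.integral_congr fun y hy => ?_
    rw [Set.uIcc_of_le hST] at hy
    rw [← logDeriv_completedRiemannZeta_one_sub_conj (by simpa using (hS.trans_le hy.1).ne')]
    congr 1
    simp only [map_add, map_mul, conj_ofReal, conj_I]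
    push_cast
    ring
  have hcc : ContinuousOn (fun y : ℝ => -conj (logDeriv completedRiemannZeta ((2 : ℝ) + y * I)))
      (Set.uIcc S T) := (continuous_conj.comp_continuousOn hc).neg
  rw [h1, ← mul_sub, ← intervalIntegral.integral_sub hc.intervalIntegrable hcc.intervalIntegrable,
    ← intervalIntegral.integral_ofReal, mul_comm 2 I, mul_assoc]
  congr 1
  rw [← intervalIntegral.integral_const_mul]
  refine intervalIntegral.integral_congr fun x _ => ?_
  apply Complex.ext
  · simp; ring
  · simp

-- Argument principle on [-1, 2] × [S, T], folded along Re s = 1/2. Taking S > 0 leaves the poles 0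
-- and 1 of Λ outside.
open Complex in
theorem pi_mul_zetaZeroCount_sub {S T : ℝ} (hS : 0 < S) (hST : S ≤ T)
    (hS0 : ∀ s : ℂ, riemannZeta s = 0 → s.im ≠ S) (hT0 : ∀ s : ℂ, riemannZeta s = 0 → s.im ≠ T) :
    Real.pi * ((zetaZeroCount T : ℝ) - zetaZeroCount S)
      = (∫ x in (1 / 2 : ℝ)..2, (logDeriv completedRiemannZeta (x + S * I)).im)
        - (∫ x in (1 / 2 : ℝ)..2, (logDeriv completedRiemannZeta (x + T * I)).im)
        + ∫ y in S..T, (logDeriv completedRiemannZeta ((2 : ℝ) + y * I)).re := by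
  classical
  have hsub : zetaZerosUpTo S ⊆ zetaZerosUpTo T := fun s hs => by
    rw [mem_zetaZerosUpTo] at *
    exact ⟨hs.1, hs.2.1, hs.2.2.trans hST⟩
  set Z := zetaZerosUpTo T \ zetaZerosUpTo S with hZ
  have him : ∀ z ∈ Set.Icc (-1 : ℝ) 2 ×ℂ Set.Icc S T, z.im ≠ 0 := fun z hz =>
    (hS.trans_le hz.2.1).ne'
  have hmem : ∀ ρ, ρ ∈ Z ↔ ρ ∈ Set.Icc (-1 : ℝ) 2 ×ℂ Set.Icc S T ∧ completedRiemannZeta ρ = 0 := by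
    intro ρ
    rw [hZ, Finset.mem_sdiff, mem_zetaZerosUpTo, mem_zetaZerosUpTo]
    constructor
    · rintro ⟨⟨h0, h1, h2⟩, h3⟩
      have hre := re_mem_Ioo_of_riemannZeta_eq_zero h1.ne' h0
      have h4 : S < ρ.im := by
        by_contra! h
        exact h3 ⟨h0, h1, h⟩
      exact ⟨⟨⟨by linarith [hre.1], by linarith [hre.2]⟩, h4.le, h2⟩,
        (completedRiemannZeta_eq_zero_iff h1.ne').2 h0⟩
    · rintro ⟨h1, h2⟩
      rw [completedRiemannZeta_eq_zero_iff (him ρ h1)] at h2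
      exact ⟨⟨h2, hS.trans_le h1.2.1, h1.2.2⟩, fun h3 => hS0 ρ h2 (le_antisymm h3.2.2 h1.2.1)⟩
  have hcount : ((zetaZeroCount T : ℂ) - zetaZeroCount S)
      = ∑ ρ ∈ Z, (analyticOrderNatAt completedRiemannZeta ρ : ℂ) := by
    rw [zetaZeroCount, zetaZeroCount, ← Finset.sum_sdiff hsub, ← hZ]
    push_cast
    rw [add_sub_cancel_right]
    refine Finset.sum_congr rfl fun ρ hρ => ?_
    rw [analyticOrderNatAt, analyticOrderNatAt,
      analyticOrderAt_completedRiemannZeta (him ρ ((hmem ρ).1 hρ).1)]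
  have harg := rectIntegral_logDeriv (f := completedRiemannZeta) (a := -1) (b := 2) (c := S) (d := T)
    (by norm_num) hST (fun z hz => analyticAt_completedRiemannZeta (him z hz))
    (fun z hz => by
      rw [analyticOrderAt_completedRiemannZeta (him z hz)]
      exact analyticOrderAt_riemannZeta_ne_top (ne_one_of_im_ne_zero (him z hz)))
    (fun z hz h => by
      have hz0 : z.im ≠ 0 := by
        rcases hz with ⟨_, h | h⟩ | ⟨h, _⟩
        · rw [h]; exact hS.ne'
        · rw [h]; exact (hS.trans_le hST).ne'
        · exact (hS.trans_le h.1).ne'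
      rw [completedRiemannZeta_eq_zero_iff hz0] at h
      have hre := re_mem_Ioo_of_riemannZeta_eq_zero hz0 h
      rcases hz with ⟨_, h' | h'⟩ | ⟨_, h' | h'⟩
      · exact hS0 z h h'
      · exact hT0 z h h'
      · rw [h'] at hre; linarith [hre.1]
      · rw [h'] at hre; linarith [hre.2]) Z hmem
  rw [← hcount, rectIntegral, add_sub_assoc, integral_logDeriv_completedRiemannZeta_vertical hS hST,
    integral_logDeriv_completedRiemannZeta_horizontal hS hS0,
    integral_logDeriv_completedRiemannZeta_horizontal (hS.trans_le hST) hT0] at harg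
  have h2I : (2 * I : ℂ) ≠ 0 := by simp
  have := mul_left_cancel₀ h2I (a := 2 * I) (b := ((Real.pi * ((zetaZeroCount T : ℝ) - zetaZeroCount S) : ℝ) : ℂ))
    (c := (((∫ x in (1 / 2 : ℝ)..2, (logDeriv completedRiemannZeta (x + S * I)).im)
        - (∫ x in (1 / 2 : ℝ)..2, (logDeriv completedRiemannZeta (x + T * I)).im)
        + ∫ y in S..T, (logDeriv completedRiemannZeta ((2 : ℝ) + y * I)).re : ℝ) : ℂ)) (by
      push_cast
      push_cast at harg
      linear_combination -harg)
  exact_mod_cast this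

-- `Gammaℝ` has neither zeros nor poles on [1/2, 2] × [S, T], so Cauchy's theorem moves the path to
-- the critical line. Thus the Gamma part of the zero count is exactly an increment of ϑ.
open Complex in
theorem rsTheta_sub_eq {S T : ℝ} (hST : S ≤ T) :
    rsTheta T - rsTheta S
      = (∫ x in (1 / 2 : ℝ)..2, (logDeriv Gammaℝ (x + S * I)).im)
        - (∫ x in (1 / 2 : ℝ)..2, (logDeriv Gammaℝ (x + T * I)).im)
        + ∫ y in S..T, (logDeriv Gammaℝ ((2 : ℝ) + y * I)).re := by
  have hd : DifferentiableOn ℂ (logDeriv Gammaℝ) (Set.Icc (1 / 2) 2 ×ℂ Set.Icc S T) := fun z hz =>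
    (differentiableAt_logDeriv_Gammaℝ (by linarith [hz.1.1])).differentiableWithinAt
  have hsub : rectBoundary (1 / 2) 2 S T ⊆ Set.Icc (1 / 2) 2 ×ℂ Set.Icc S T := by
    rintro z (⟨h, h' | h'⟩ | ⟨h, h' | h'⟩) <;>
      simp only [Complex.mem_reProdIm, h', h, true_and] <;> simp [hST] <;> norm_num
  have hc := hd.continuousOn.mono hsub
  have h0 := rectIntegral_eq_zero (by norm_num) hST hd
  have i1 := hc.bottom_side (by norm_num)
  have i2 := hc.top_side (by norm_num)
  have i3 := hc.right_side hST
  have i4 := hc.left_side hST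
  have h1 := congrArg im h0
  simp only [rectIntegral, sub_im, add_im, I_mul_im, zero_im] at h1
  have e1 := imCLM.intervalIntegral_comp_comm i1
  have e2 := imCLM.intervalIntegral_comp_comm i2
  have e3 := reCLM.intervalIntegral_comp_comm i3
  have e4 := reCLM.intervalIntegral_comp_comm i4
  simp only [imCLM_apply, reCLM_apply] at e1 e2 e3 e4
  rw [← e1, ← e2, ← e3, ← e4] at h1
  have hθ : rsTheta T - rsTheta S = ∫ y in S..T, (logDeriv Gammaℝ ((1 / 2 : ℝ) + y * I)).re := by
    rw [rsTheta, rsTheta, intervalIntegral.integral_interval_sub_left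
      (continuous_re_logDeriv_Gammaℝ.intervalIntegrable _ _)
      (continuous_re_logDeriv_Gammaℝ.intervalIntegrable _ _)]
    push_cast
    rfl
  rw [hθ]
  linarith

-- On Re s = 2 the values of ζ lie in the right half-plane, so the principal argument is a primitive
-- of the integrand.
open Complex in
theorem abs_integral_re_logDeriv_riemannZeta_le {S T : ℝ} :
    |∫ y in S..T, (logDeriv riemannZeta ((2 : ℝ) + y * I)).re| ≤ 2 * Real.pi := by
  have hslit : ∀ y : ℝ, riemannZeta ((2 : ℝ) + y * I) ∈ slitPlane := fun y => by
    left
    have h := (abs_re_le_norm _).trans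
      (norm_riemannZeta_sub_one_le (s := (2 : ℝ) + y * I) (by simp))
    rw [sub_re, one_re, abs_le] at h
    linarith [h.1]
  have hne1 : ∀ y : ℝ, ((2 : ℝ) + y * I : ℂ) ≠ 1 := fun y h => by
    have := congrArg re h
    simp at this
  have hd : ∀ y : ℝ, HasDerivAt (fun y : ℝ => (log (riemannZeta ((2 : ℝ) + y * I))).im)
      (logDeriv riemannZeta ((2 : ℝ) + y * I)).re y := fun y => by
    have h1 : HasDerivAt (fun y : ℝ => ((2 : ℝ) + y * I : ℂ)) (1 * I) y :=
      ((hasDerivAt_id y).ofReal_comp.mul_const I).const_add _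
    have h2 := (differentiableAt_riemannZeta (hne1 y)).hasDerivAt.scomp y h1
    have h3 := imCLM.hasFDerivAt.comp_hasDerivAt y (h2.clog_real (hslit y))
    refine h3.congr_deriv ?_
    rw [imCLM_apply, logDeriv_apply, smul_eq_mul, one_mul, mul_div_assoc, I_mul_im]
    rfl
  have hc : Continuous fun y : ℝ => (logDeriv riemannZeta ((2 : ℝ) + y * I)).re := by
    refine continuous_re.comp (continuous_iff_continuousAt.2 fun y => ?_)
    exact ContinuousAt.comp (f := fun y : ℝ => ((2 : ℝ) + y * I : ℂ))
      (differentiableAt_logDeriv_riemannZeta (hne1 y)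
        (riemannZeta_ne_zero_of_one_le_re (by simp))).continuousAt (by fun_prop)
  rw [intervalIntegral.integral_eq_sub_of_hasDerivAt (fun y _ => hd y) (hc.intervalIntegrable _ _)]
  simp only [log_im]
  refine (abs_sub _ _).trans ?_
  linarith [abs_arg_le_pi (riemannZeta ((2 : ℝ) + T * I)), abs_arg_le_pi (riemannZeta ((2 : ℝ) + S * I))]

open Complex in
theorem continuous_logDeriv_riemannZeta_horizontal {t : ℝ} (ht : t ≠ 0)
    (h : ∀ s : ℂ, riemannZeta s = 0 → s.im ≠ t) :
    Continuous fun x : ℝ => logDeriv riemannZeta (x + t * I) := by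
  have him : ∀ x : ℝ, (x + t * I : ℂ).im = t := fun x => by simp
  exact continuous_iff_continuousAt.2 fun x =>
      ContinuousAt.comp (f := fun x : ℝ => (x + t * I : ℂ))
        (differentiableAt_logDeriv_riemannZeta (ne_one_of_im_ne_zero (by rwa [him]))
          (fun h0 => h _ h0 (him x))).continuousAt (by fun_prop)

open Complex in
theorem integral_im_logDeriv_completedRiemannZeta {t : ℝ} (ht : t ≠ 0)
    (h : ∀ s : ℂ, riemannZeta s = 0 → s.im ≠ t) :
    ∫ x in (1 / 2 : ℝ)..2, (logDeriv completedRiemannZeta (x + t * I)).im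
      = (∫ x in (1 / 2 : ℝ)..2, (logDeriv Gammaℝ (x + t * I)).im) + zetaArgVariation t := by
  have him : ∀ x : ℝ, (x + t * I : ℂ).im = t := fun x => by simp
  have hc : ContinuousOn (fun x : ℝ => (logDeriv Gammaℝ (x + t * I)).im) (Set.uIcc (1 / 2) 2) := by
    refine continuous_im.comp_continuousOn fun x hx => ContinuousAt.continuousWithinAt ?_
    rw [Set.uIcc_of_le (by norm_num)] at hx
    exact ContinuousAt.comp (f := fun x : ℝ => (x + t * I : ℂ))
      (differentiableAt_logDeriv_Gammaℝ (by simp; linarith [hx.1])).continuousAt (by fun_prop)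
  have hz : Continuous fun x : ℝ => (logDeriv riemannZeta (x + t * I)).im :=
    continuous_im.comp (continuous_logDeriv_riemannZeta_horizontal ht h)
  rw [zetaArgVariation, ← intervalIntegral.integral_add hc.intervalIntegrable
    (hz.intervalIntegrable _ _)]
  refine intervalIntegral.integral_congr fun x hx => ?_
  rw [Set.uIcc_of_le (by norm_num)] at hx
  simp only [← add_im]
  rw [logDeriv_completedRiemannZeta (by rwa [him]) (by simp; linarith [hx.1])
    (fun h0 => h _ h0 (him x))]

open Complex in
/-- The **Riemann–von Mangoldt formula**, with the argument of `ζ` as error term. -/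
theorem exists_abs_pi_mul_zetaZeroCount_sub_le :
    ∃ C : ℝ, ∀ T : ℝ, 1 ≤ T → (∀ s : ℂ, riemannZeta s = 0 → s.im ≠ T) →
      |Real.pi * zetaZeroCount T - rsTheta T + zetaArgVariation T| ≤ C := by
  -- The lower height S is fixed once and for all, so everything evaluated at S is a constant.
  obtain ⟨S, hS, hS0⟩ := exists_mem_Ioo_not_ordinate le_rfl (zero_lt_one' ℝ)
  refine ⟨|Real.pi * zetaZeroCount S - rsTheta S + zetaArgVariation S| + 2 * Real.pi,
    fun T hT hT0 => ?_⟩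
  have hST : S ≤ T := hS.2.le.trans hT
  have hTpos : 0 < T := one_pos.trans_le hT
  have h1 := pi_mul_zetaZeroCount_sub hS.1 hST hS0 hT0
  rw [integral_im_logDeriv_completedRiemannZeta hS.1.ne' hS0,
    integral_im_logDeriv_completedRiemannZeta hTpos.ne' hT0] at h1
  have h2 := rsTheta_sub_eq hST
  have h3 : ∫ y in S..T, (logDeriv completedRiemannZeta ((2 : ℝ) + y * I)).re
      = (∫ y in S..T, (logDeriv Gammaℝ ((2 : ℝ) + y * I)).re)
        + ∫ y in S..T, (logDeriv riemannZeta ((2 : ℝ) + y * I)).re := by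
    rw [← intervalIntegral.integral_add]
    · refine intervalIntegral.integral_congr fun y hy => ?_
      rw [Set.uIcc_of_le hST] at hy
      simp only [← add_re]
      rw [logDeriv_completedRiemannZeta (by simpa using (hS.1.trans_le hy.1).ne') (by simp)
        (riemannZeta_ne_zero_of_one_le_re (by simp))]
    · refine (continuous_re.comp (continuous_iff_continuousAt.2 fun y => ?_)).intervalIntegrable _ _
      exact ContinuousAt.comp (f := fun y : ℝ => ((2 : ℝ) + y * I : ℂ))
        (differentiableAt_logDeriv_Gammaℝ (by simp)).continuousAt (by fun_prop)
    · refine (continuous_re.comp (continuous_iff_continuousAt.2 fun y => ?_)).intervalIntegrable _ _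
      exact ContinuousAt.comp (f := fun y : ℝ => ((2 : ℝ) + y * I : ℂ))
        (differentiableAt_logDeriv_riemannZeta (fun h => by
          have := congrArg re h
          simp at this) (riemannZeta_ne_zero_of_one_le_re (by simp))).continuousAt (by fun_prop)
  have h4 := abs_integral_re_logDeriv_riemannZeta_le (S := S) (T := T)
  have h5 : Real.pi * zetaZeroCount T - rsTheta T + zetaArgVariation T
      = (Real.pi * zetaZeroCount S - rsTheta S + zetaArgVariation S)
        + ∫ y in S..T, (logDeriv riemannZeta ((2 : ℝ) + y * I)).re := by
    linarith
  rw [h5]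
  exact (abs_add_le _ _).trans (add_le_add le_rfl h4)

/-! ### The unconditional bound for the variation of arg ζ. -/

noncomputable section

/-- The zeros of `ζ` at distance at most `17/10` from `2 + iT`. -/
def zetaZerosNear (T : ℝ) : Finset ℂ :=
  ((isCompact_closedBall ((2 : ℂ) + T * Complex.I) (17 / 10)).inter_riemannZetaZeros_finite).toFinset

end

theorem mem_zetaZerosNear {T : ℝ} {ρ : ℂ} : ρ ∈ zetaZerosNear T ↔
    ρ ∈ Metric.closedBall ((2 : ℂ) + T * Complex.I) (17 / 10) ∧ riemannZeta ρ = 0 := by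
  simp [zetaZerosNear, mem_riemannZetaZeros]

-- The radii satisfy 3/2 < 17/10 < 19/10 < 2: the inner disc about 2 + iT reaches the critical line,
-- and the outer one stays in Re ≥ 1/10, where |ζ| ≤ 11 (T + 4). For T ≥ 3 this is at most T^6 / 3,
-- and 1/3 bounds |ζ| below at the centre; hence M = 6 log T.
open Complex in
theorem exists_norm_logDeriv_riemannZeta_sub_sum_le :
    ∃ C > 0, ∀ T : ℝ, 3 ≤ T →
      (∑ ρ ∈ zetaZerosNear T, (analyticOrderNatAt riemannZeta ρ : ℝ) ≤ C * Real.log T) ∧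
      ∀ z ∈ Metric.closedBall ((2 : ℂ) + T * I) (3 / 2), riemannZeta z ≠ 0 →
        ‖logDeriv riemannZeta z
          - ∑ ρ ∈ zetaZerosNear T, (analyticOrderNatAt riemannZeta ρ : ℂ) / (z - ρ)‖
          ≤ C * Real.log T := by
  obtain ⟨C, hC, h⟩ := exists_norm_logDeriv_sub_sum_le (r := 3 / 2) (r₁ := 17 / 10) (R := 19 / 10)
    (by norm_num) (by norm_num) (by norm_num)
  refine ⟨C * 6, by positivity, fun T hT => ?_⟩
  have hlog : 0 < Real.log T := Real.log_pos (by linarith)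
  have hball : ∀ z ∈ Metric.closedBall ((2 : ℂ) + T * I) (19 / 10), 1 / 10 ≤ z.re ∧ 1 ≤ z.im ∧
      ‖z‖ ≤ T + 4 := fun z hz => by
    rw [Metric.mem_closedBall, dist_eq_norm] at hz
    have h1 := (abs_re_le_norm _).trans hz
    have h2 := (abs_im_le_norm _).trans hz
    simp only [sub_re, sub_im, add_re, add_im, mul_re, mul_im, ofReal_re, ofReal_im, I_re, I_im,
      re_ofNat, im_ofNat] at h1 h2
    rw [abs_le] at h1 h2
    refine ⟨by linarith [h1.1], by linarith [h2.1], ?_⟩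
    have h3 : ‖(2 : ℂ) + T * I‖ ≤ 2 + T := (norm_add_le _ _).trans (by
      simp [abs_of_pos (by linarith : 0 < T)])
    have h4 := norm_le_norm_add_norm_sub' z ((2 : ℂ) + T * I)
    linarith
  have hc : (1 : ℝ) / 3 ≤ ‖riemannZeta ((2 : ℂ) + T * I)‖ := by
    have h1 := norm_riemannZeta_sub_one_le (s := (2 : ℂ) + T * I) (by simp)
    have h2 := norm_sub_norm_le (1 : ℂ) (1 - riemannZeta ((2 : ℂ) + T * I))
    rw [norm_one, sub_sub_cancel, norm_sub_rev] at h2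
    linarith
  have hne1 : ∀ z ∈ Metric.closedBall ((2 : ℂ) + T * I) (19 / 10), z ≠ 1 := fun z hz =>
    ne_one_of_im_ne_zero (by linarith [(hball z hz).2.1])
  have key := h riemannZeta (2 + T * I) (6 * Real.log T) (zetaZerosNear T) (by positivity)
    (fun z hz => analyticAt_riemannZeta (hne1 z hz))
    (fun h0 => by rw [h0, norm_zero] at hc; norm_num at hc) (fun z hz => ?_)
    (fun ρ => mem_zetaZerosNear)
  · rw [mul_assoc]
    exact key
  · obtain ⟨h1, h2, h3⟩ := hball z hz
    refine (norm_riemannZeta_le (by linarith) (hne1 z hz)).trans ?_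
    have h4 : 1 ≤ ‖z - 1‖ := by
      have := (abs_im_le_norm (z - 1))
      rw [sub_im, one_im, sub_zero, abs_of_pos (by linarith)] at this
      linarith
    have h5 : ‖z - 1‖⁻¹ + 1 / z.re ≤ 11 := by
      have : 1 / z.re ≤ 10 := by
        rw [div_le_iff₀ (by linarith)]; linarith
      have := inv_le_one_of_one_le₀ h4
      linarith
    have h6 : Real.exp (6 * Real.log T) = T ^ 6 := by
      rw [mul_comm, Real.exp_mul, Real.exp_log (by linarith)]
      exact_mod_cast Real.rpow_natCast T 6
    rw [h6]
    have h7 : (3 : ℝ) ^ 5 ≤ T ^ 5 := by gcongr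
    calc ‖z‖ * (‖z - 1‖⁻¹ + 1 / z.re) ≤ (T + 4) * 11 := by gcongr
      _ ≤ T ^ 6 * (1 / 3) := by nlinarith
      _ ≤ _ := by gcongr

-- The imaginary part of 1/(x + it - ρ) keeps one sign in x, so the integral of its absolute value
-- is a change of the principal argument.
open Complex in
theorem integral_abs_im_inv_le {a b t : ℝ} {ρ : ℂ} (ht : t ≠ ρ.im) :
    ∫ x : ℝ in a..b, |((x + t * I - ρ)⁻¹).im| ≤ 2 * Real.pi := by
  have him : ∀ x : ℝ, (x + t * I - ρ).im = t - ρ.im := fun x => by simp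
  have hne : ∀ x : ℝ, (x + t * I - ρ) ≠ 0 := fun x h => by
    have := him x
    rw [h, zero_im] at this
    exact ht (by linarith)
  have hc : Continuous fun x : ℝ => (x + t * I - ρ)⁻¹ := Continuous.inv₀ (by fun_prop) hne
  have h1 := integral_inv_horizontal (a := a) (b := b) (y := t) (w := ρ) (k := 1)
    (fun x _ => Or.inr (by rw [one_mul, him]; exact sub_ne_zero.2 ht)) one_ne_zero
  have h2 := congrArg im h1
  rw [← imCLM_apply, ← imCLM.intervalIntegral_comp_comm (hc.intervalIntegrable _ _)] at h2
  simp only [imCLM_apply, one_mul, sub_im (log _), log_im] at h2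
  have h3 : |∫ x : ℝ in a..b, ((x + t * I - ρ)⁻¹).im| ≤ 2 * Real.pi := by
    rw [h2]
    refine (abs_sub _ _).trans ?_
    linarith [abs_arg_le_pi (b + t * I - ρ), abs_arg_le_pi (a + t * I - ρ)]
  have him2 : ∀ x : ℝ, ((x + t * I - ρ)⁻¹).im = -(t - ρ.im) / normSq (x + t * I - ρ) := fun x => by
    rw [inv_im, him]
  rcases lt_or_gt_of_ne ht with h | h
  · have : ∀ x : ℝ, |((x + t * I - ρ)⁻¹).im| = ((x + t * I - ρ)⁻¹).im := fun x => by
      refine abs_of_nonneg ?_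
      rw [him2]
      exact div_nonneg (by linarith) (normSq_nonneg _)
    simp only [this]
    exact (le_abs_self _).trans h3
  · have : ∀ x : ℝ, |((x + t * I - ρ)⁻¹).im| = -((x + t * I - ρ)⁻¹).im := fun x => by
      refine abs_of_nonpos ?_
      rw [him2]
      exact div_nonpos_of_nonpos_of_nonneg (by linarith) (normSq_nonneg _)
    simp only [this, intervalIntegral.integral_neg]
    exact (neg_le_abs _).trans h3

open Complex in
theorem continuous_abs_im_inv {t : ℝ} {ρ : ℂ} (ht : t ≠ ρ.im) :
    Continuous fun x : ℝ => |((x + t * I - ρ)⁻¹).im| := by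
  have hne : ∀ x : ℝ, (x + t * I - ρ) ≠ 0 := fun x h => by
    have := congrArg im h
    simp at this
    exact ht (by linarith)
  exact (continuous_im.comp (Continuous.inv₀ (by fun_prop) hne)).abs

open Complex in
theorem horizontal_mem_closedBall {x T : ℝ} (hx : x ∈ Set.Icc (1 / 2) 2) :
    (x + T * I : ℂ) ∈ Metric.closedBall ((2 : ℂ) + T * I) (3 / 2) := by
  rw [Metric.mem_closedBall, dist_eq_norm, add_sub_add_right_eq_sub]
  have : ((x : ℂ) - 2) = ((x - 2 : ℝ) : ℂ) := by push_cast; ring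
  rw [this, norm_real, Real.norm_eq_abs, abs_le]
  constructor <;> linarith [hx.1, hx.2]

-- The weights are the multiplicities in the unconditional estimate, and smaller quantities,
-- proportional to the length of the interval, in the estimate under RH.
open Complex in
theorem abs_integral_le_of_abs_le_add_sum {F : ℝ → ℝ} {a b t A : ℝ} (hab : a ≤ b) {Z : Finset ℂ}
    (hZ : ∀ ρ ∈ Z, t ≠ ρ.im) {w : ℂ → ℝ} (hw : ∀ ρ ∈ Z, 0 ≤ w ρ)
    (hF : ∀ x ∈ Set.Icc a b, |F x| ≤ A + ∑ ρ ∈ Z, w ρ * |((x + t * I - ρ)⁻¹).im|) :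
    |∫ x in a..b, F x| ≤ A * (b - a) + 2 * Real.pi * ∑ ρ ∈ Z, w ρ := by
  have hterm : ∀ ρ ∈ Z, Continuous fun x : ℝ => w ρ * |((x + t * I - ρ)⁻¹).im| := fun ρ hρ =>
    continuous_const.mul (continuous_abs_im_inv (hZ ρ hρ))
  have hsum : Continuous fun x : ℝ => ∑ ρ ∈ Z, w ρ * |((x + t * I - ρ)⁻¹).im| :=
    continuous_finsetSum _ hterm
  rw [← Real.norm_eq_abs]
  refine (intervalIntegral.norm_integral_le_of_norm_le hab
    (g := fun x : ℝ => A + ∑ ρ ∈ Z, w ρ * |((x + t * I - ρ)⁻¹).im|)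
    (Eventually.of_forall fun x hx => hF x (Set.Ioc_subset_Icc_self hx))
    ((continuous_const.add hsum).intervalIntegrable _ _)).trans ?_
  rw [intervalIntegral.integral_add intervalIntegrable_const (hsum.intervalIntegrable _ _),
    intervalIntegral.integral_finsetSum fun ρ hρ => (hterm ρ hρ).intervalIntegrable _ _,
    intervalIntegral.integral_const, smul_eq_mul, mul_comm A, Finset.mul_sum]
  gcongr with ρ hρ
  rw [intervalIntegral.integral_const_mul, mul_comm]
  exact mul_le_mul_of_nonneg_right (integral_abs_im_inv_le (hZ ρ hρ)) (hw ρ hρ)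

open Complex in
/-- `S(T) = O(log T)`. -/
theorem exists_abs_zetaArgVariation_le :
    ∃ C > 0, ∀ T : ℝ, 3 ≤ T → (∀ s : ℂ, riemannZeta s = 0 → s.im ≠ T) →
      |zetaArgVariation T| ≤ C * Real.log T := by
  obtain ⟨C, hC, h⟩ := exists_norm_logDeriv_riemannZeta_sub_sum_le
  refine ⟨C * (3 / 2) + C * (2 * Real.pi), by positivity, fun T hT hT0 => ?_⟩
  have hlog : 0 < Real.log T := Real.log_pos (by linarith)
  obtain ⟨hcount, hloc⟩ := h T hT
  have key := abs_integral_le_of_abs_le_add_sum (F := fun x : ℝ => (logDeriv riemannZeta (x + T * I)).im)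
    (a := 1 / 2) (b := 2) (t := T) (A := C * Real.log T) (by norm_num) (Z := zetaZerosNear T)
    (fun ρ hρ => (hT0 ρ (mem_zetaZerosNear.1 hρ).2).symm)
    (w := fun ρ => (analyticOrderNatAt riemannZeta ρ : ℝ)) (fun ρ _ => by positivity) (fun x hx => ?_)
  · refine key.trans ?_
    have := mul_le_mul_of_nonneg_left hcount (by positivity : 0 ≤ 2 * Real.pi)
    linarith
  · have h1 := (abs_im_le_norm _).trans (hloc _ (horizontal_mem_closedBall hx)
      (fun h0 => hT0 _ h0 (by simp)))
    rw [sub_im, im_sum] at h1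
    have h2 : |∑ ρ ∈ zetaZerosNear T, ((analyticOrderNatAt riemannZeta ρ : ℂ) / (x + T * I - ρ)).im|
        ≤ ∑ ρ ∈ zetaZerosNear T,
          (analyticOrderNatAt riemannZeta ρ : ℝ) * |((x + T * I - ρ)⁻¹).im| := by
      refine (Finset.abs_sum_le_sum_abs _ _).trans (Finset.sum_le_sum fun ρ _ => ?_)
      rw [div_eq_mul_inv, ← ofReal_natCast, im_ofReal_mul, abs_mul, Nat.abs_cast]
    have h3 := abs_sub_abs_le_abs_sub (logDeriv riemannZeta (x + T * I)).im
      (∑ ρ ∈ zetaZerosNear T, ((analyticOrderNatAt riemannZeta ρ : ℂ) / (x + T * I - ρ)).im)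
    linarith

/-! ### The variation of arg ζ under the Riemann hypothesis. -/

open Complex Metric in
/-- A consequence of Hadamard's three circles theorem. -/
theorem norm_le_rpow_of_norm_le_inner {w : ℂ → ℂ} {c : ℂ} {r R m : ℝ} (hr : 0 < r) (hrR : r < R)
    (hw : ∀ z ∈ closedBall c R, DifferentiableAt ℂ w z) (hw1 : ∀ z ∈ closedBall c R, ‖w z‖ ≤ 1)
    (hwm : ∀ z ∈ closedBall c r, ‖w z‖ ≤ m) {z : ℂ} (hz : ‖z - c‖ ∈ Set.Icc r R) :
    ‖w z‖ ≤ m ^ ((Real.log R - Real.log ‖z - c‖) / (Real.log R - Real.log r)) := by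
  have hR : 0 < R := hr.trans hrR
  have hlog : Real.log r < Real.log R := Real.log_lt_log hr hrR
  have hz0 : 0 < ‖z - c‖ := hr.trans_le hz.1
  have hzc : z - c ≠ 0 := norm_pos_iff.1 hz0
  -- The exponential unrolls the annulus into a vertical strip, where the three lines theorem
  -- applies.
  set f : ℂ → ℂ := fun ζ => w (c + exp ζ) with hf
  have hmem : ∀ ζ ρ, 0 < ρ → ζ.re ≤ Real.log ρ → c + exp ζ ∈ closedBall c ρ := fun ζ ρ hρ h => by
    rw [mem_closedBall, dist_eq_norm, add_sub_cancel_left, norm_exp]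
    exact (Real.exp_le_exp.2 h).trans_eq (Real.exp_log hρ)
  have hclosure : closure (HadamardThreeLines.verticalStrip (Real.log r) (Real.log R))
      = HadamardThreeLines.verticalClosedStrip (Real.log r) (Real.log R) := by
    rw [HadamardThreeLines.verticalStrip, HadamardThreeLines.verticalClosedStrip,
      closure_preimage_re, closure_Ioo hlog.ne]
  have hd : DiffContOnCl ℂ f (HadamardThreeLines.verticalStrip (Real.log r) (Real.log R)) := by
    apply DifferentiableOn.diffContOnCl
    rw [hclosure]
    intro ζ hζ
    have := hw _ (hmem ζ R hR hζ.2)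
    exact (this.fun_comp' ζ (by fun_prop)).differentiableWithinAt
  have key := HadamardThreeLines.norm_le_interp_of_mem_verticalClosedStrip' (f := f)
    (z := log (z - c)) (a := m) (b := 1) hlog ?_ hd ?_ ?_ ?_
  · rw [hf] at key
    simp only [exp_log hzc, add_sub_cancel, log_re, Real.one_rpow, mul_one] at key
    convert key using 2
    have : Real.log R - Real.log r ≠ 0 := by linarith
    field_simp
    ring
  · constructor
    · rw [log_re]; exact Real.log_le_log hr hz.1
    · rw [log_re]; exact Real.log_le_log hz0 hz.2
  · refine ⟨1, ?_⟩
    rintro _ ⟨ζ, hζ, rfl⟩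
    exact hw1 _ (hmem ζ R hR hζ.2)
  · intro ζ hζ
    exact hwm _ (hmem ζ r hr (le_of_eq hζ))
  · intro ζ hζ
    exact hw1 _ (hmem ζ R hR (le_of_eq hζ))

/-- If `Re Φ ≥ -B` on a disc and `Φ` is small on a smaller concentric disc, then `Φ` is small
compared with `B` away from the boundary of the larger disc. -/
theorem norm_le_of_neg_le_re {Φ : ℂ → ℂ} {c : ℂ} {r R B b q : ℝ} (hr : 0 < r) (hrR : r < R)
    (hB : 0 < B)
    (hΦ : ∀ z ∈ Metric.closedBall c R, DifferentiableAt ℂ Φ z)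
    (hre : ∀ z ∈ Metric.closedBall c R, -B ≤ (Φ z).re)
    (hb : ∀ z ∈ Metric.closedBall c r, ‖Φ z‖ ≤ b) {z : ℂ} (hz : ‖z - c‖ ∈ Set.Icc r R)
    (hq : (b / B) ^ ((Real.log R - Real.log ‖z - c‖) / (Real.log R - Real.log r)) ≤ q)
    (hq2 : q ≤ 1 / 2) : ‖Φ z‖ ≤ 4 * B * q := by
  have hden : ∀ z ∈ Metric.closedBall c R, B ≤ (Φ z + 2 * B).re := fun z hz => by
    have := hre z hz
    simp only [Complex.add_re, Complex.mul_re, Complex.re_ofNat, Complex.ofReal_re,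
      Complex.im_ofNat, Complex.ofReal_im]
    linarith
  have hne : ∀ z ∈ Metric.closedBall c R, Φ z + 2 * B ≠ 0 := fun z hz h => by
    have := hden z hz
    rw [h, Complex.zero_re] at this
    linarith
  -- Points with Re ≥ -B are nearer to 0 than to -2B, so this Möbius map sends them into the unit
  -- disc. On the small disc |Φ + 2B| ≥ B gives |w| ≤ b/B. Solving back, Φ (1 - w) = 2 B w with |1 -
  -- w| ≥ 1/2.
  set w : ℂ → ℂ := fun z => Φ z / (Φ z + 2 * B) with hw
  have hwz := norm_le_rpow_of_norm_le_inner (w := w) (c := c) (m := b / B) hr hrR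
    (fun z hz => (hΦ z hz).div ((hΦ z hz).add_const _) (hne z hz))
    (fun z hz => by
      simp only [hw, norm_div]
      refine div_le_one_of_le₀ ?_ (norm_nonneg _)
      rw [← sq_le_sq₀ (norm_nonneg _) (norm_nonneg _), Complex.sq_norm, Complex.sq_norm,
        Complex.normSq_apply, Complex.normSq_apply]
      have := hre z hz
      simp only [Complex.add_re, Complex.mul_re, Complex.re_ofNat, Complex.ofReal_re,
        Complex.im_ofNat, Complex.ofReal_im, Complex.add_im, Complex.mul_im]
      nlinarith)
    (fun z hz => by
      have hzR := Metric.closedBall_subset_closedBall hrR.le hz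
      simp only [hw, norm_div]
      have h1 := (hden z hzR).trans ((le_abs_self _).trans (Complex.abs_re_le_norm _))
      have h2 := hb z hz
      have h3 := norm_nonneg (Φ z)
      gcongr
      exact h3.trans h2) hz
  have hwq : ‖w z‖ ≤ q := hwz.trans hq
  have hzR : z ∈ Metric.closedBall c R := by
    rw [Metric.mem_closedBall, dist_eq_norm]; exact hz.2
  have hΦw : Φ z * (1 - w z) = 2 * B * w z := by
    have := hne z hzR
    simp only [hw]
    field_simp
    ring
  have h1 : (1 : ℝ) / 2 ≤ ‖1 - w z‖ := by
    have := norm_sub_norm_le (1 : ℂ) (w z)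
    rw [norm_one] at this
    linarith
  have h2 := congrArg norm hΦw
  rw [norm_mul, norm_mul, norm_mul, Complex.norm_real, Complex.norm_ofNat,
    Real.norm_of_nonneg hB.le] at h2
  have h3 : ‖Φ z‖ * (1 / 2) ≤ ‖Φ z‖ * ‖1 - w z‖ := by gcongr
  have h4 : 2 * B * ‖w z‖ ≤ 2 * B * q := by gcongr
  linarith

theorem re_eq_half_of_riemannHypothesis (hRH : RiemannHypothesis) {ρ : ℂ} (h : riemannZeta ρ = 0)
    (hi : ρ.im ≠ 0) : ρ.re = 1 / 2 := by
  refine hRH ρ h ?_ (ne_one_of_im_ne_zero hi)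
  rintro ⟨n, hn⟩
  apply hi
  rw [hn]
  simp

-- The disc touches the critical line only at 1/2 + iT. Under RH it therefore contains no zero of ζ
-- unless T is an ordinate.
open Complex in
theorem half_le_re_of_mem_closedBall {T : ℝ} {z : ℂ}
    (hz : z ∈ Metric.closedBall ((2 : ℂ) + T * I) (3 / 2)) :
    1 / 2 ≤ z.re ∧ (z.re = 1 / 2 → z.im = T) := by
  rw [Metric.mem_closedBall, dist_eq_norm, ← sq_le_sq₀ (norm_nonneg _) (by norm_num),
    Complex.sq_norm, Complex.normSq_apply] at hz
  simp only [sub_re, sub_im, add_re, add_im, mul_re, mul_im, ofReal_re, ofReal_im, I_re, I_im,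
    re_ofNat, im_ofNat] at hz
  constructor
  · nlinarith [sq_nonneg (z.im - T)]
  · intro h
    rw [h] at hz
    have : (z.im - T) ^ 2 ≤ 0 := by nlinarith
    nlinarith [pow_eq_zero_iff (two_ne_zero) |>.1 (le_antisymm this (sq_nonneg _))]

open Complex in
/-- Under RH, `ζ'/ζ` is small compared with `log T` to the right of the critical line. -/
theorem exists_norm_logDeriv_riemannZeta_le_exp (hRH : RiemannHypothesis) :
    ∃ C > 0, ∀ T : ℝ, 3 ≤ T → (∀ s : ℂ, riemannZeta s = 0 → s.im ≠ T) →
      ∀ x ∈ Set.Icc (1 / 2 : ℝ) (3 / 2), 3 ≤ (x - 1 / 2) * Real.log (Real.log T) →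
        ‖logDeriv riemannZeta (x + T * I)‖
          ≤ C * Real.log T * Real.exp (-((x - 1 / 2) * Real.log (Real.log T) / 3)) := by
  obtain ⟨C, hC, h⟩ := exists_norm_logDeriv_riemannZeta_sub_sum_le
  obtain ⟨b, hb, hbound⟩ := exists_norm_logDeriv_riemannZeta_le
  refine ⟨4 * (C + b), by positivity, fun T hT hT0 x hx hx3 => ?_⟩
  have hlog1 : 1 < Real.log T := by
    rw [Real.lt_log_iff_exp_lt (by linarith)]
    linarith [Real.exp_one_lt_d9]
  have hlog : 0 < Real.log T := by linarith
  obtain ⟨-, hloc⟩ := h T hT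
  set B := (C + b) * Real.log T with hBdef
  have hB : 0 < B := by positivity
  have him : ∀ z ∈ Metric.closedBall ((2 : ℂ) + T * I) (3 / 2), z.im ≠ 0 := fun z hz => by
    rw [Metric.mem_closedBall, dist_eq_norm] at hz
    have h2 := (abs_im_le_norm _).trans hz
    simp only [sub_im, add_im, mul_im, ofReal_re, ofReal_im, I_re, I_im, im_ofNat] at h2
    rw [abs_le] at h2
    linarith [h2.1]
  have hζ : ∀ z ∈ Metric.closedBall ((2 : ℂ) + T * I) (3 / 2), riemannZeta z ≠ 0 := fun z hz h0 =>
    hT0 z h0 ((half_le_re_of_mem_closedBall hz).2 (re_eq_half_of_riemannHypothesis hRH h0 (him z hz)))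
  have hnorm : ‖(x + T * I : ℂ) - ((2 : ℂ) + T * I)‖ = 2 - x := by
    rw [add_sub_add_right_eq_sub]
    have : ((x : ℂ) - 2) = ((x - 2 : ℝ) : ℂ) := by push_cast; ring
    rw [this, norm_real, Real.norm_eq_abs, abs_of_nonpos (by linarith [hx.2])]
    ring
  set q := Real.exp (-((x - 1 / 2) * Real.log (Real.log T) / 3)) with hq
  have key := norm_le_of_neg_le_re (Φ := logDeriv riemannZeta) (c := (2 : ℂ) + T * I) (r := 1 / 2)
    (R := 3 / 2) (B := B) (b := b) (q := q) (z := x + T * I) (by norm_num) (by norm_num) hB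
    (fun z hz => differentiableAt_logDeriv_riemannZeta (ne_one_of_im_ne_zero (him z hz)) (hζ z hz))
    ?_ ?_ ?_ ?_ ?_
  · rw [hBdef] at key
    linarith
  -- All zeros have real part 1/2 ≤ Re z, so every term of Landau's sum has nonnegative real part
  -- and only the error term can be negative.
  · intro z hz
    have h1 := (abs_re_le_norm _).trans (hloc z hz (hζ z hz))
    rw [sub_re, abs_le, re_sum] at h1
    have h2 : 0 ≤ ∑ ρ ∈ zetaZerosNear T, ((analyticOrderNatAt riemannZeta ρ : ℂ) / (z - ρ)).re := by
      refine Finset.sum_nonneg fun ρ hρ => ?_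
      obtain ⟨hρ1, hρ2⟩ := mem_zetaZerosNear.1 hρ
      have hρim : ρ.im ≠ 0 := by
        rw [Metric.mem_closedBall, dist_eq_norm] at hρ1
        have h2 := (abs_im_le_norm _).trans hρ1
        simp only [sub_im, add_im, mul_im, ofReal_re, ofReal_im, I_re, I_im, im_ofNat] at h2
        rw [abs_le] at h2
        linarith [h2.1]
      rw [div_eq_mul_inv, ← ofReal_natCast, re_ofReal_mul, inv_re, sub_re,
        re_eq_half_of_riemannHypothesis hRH hρ2 hρim]
      have := (half_le_re_of_mem_closedBall hz).1
      exact mul_nonneg (by positivity) (div_nonneg (by linarith) (normSq_nonneg _))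
    have h3 : C * Real.log T ≤ B := by rw [hBdef]; nlinarith
    linarith [h1.1]
  · intro z hz
    refine hbound z ?_
    rw [Metric.mem_closedBall, dist_eq_norm] at hz
    have h2 := (abs_re_le_norm _).trans hz
    simp only [sub_re, add_re, mul_re, ofReal_re, ofReal_im, I_re, I_im, re_ofNat] at h2
    rw [abs_le] at h2
    linarith [h2.1]
  · rw [hnorm]
    constructor <;> linarith [hx.1, hx.2]
  · rw [hnorm]
    have hbB : b / B ≤ (Real.log T)⁻¹ := by
      rw [hBdef, div_le_iff₀ (by positivity)]
      field_simp
      linarith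
    have hx2 : 0 < 2 - x := by linarith [hx.2]
    have hden : Real.log (3 / 2) - Real.log (1 / 2) = Real.log 3 := by
      rw [← Real.log_div (by norm_num) (by norm_num)]
      norm_num
    have hlog3 : Real.log 3 ≤ 2 := by
      have := Real.log_le_sub_one_of_pos (x := 3) (by norm_num)
      linarith
    have hlog3' : 0 < Real.log 3 := Real.log_pos (by norm_num)
    -- From log y ≥ 1 - 1/y with y = (3/2)/(2 - x). Together with log 3 ≤ 2 this makes the
    -- interpolation exponent at least (x - 1/2)/3.
    have hnum : (2 / 3) * (x - 1 / 2) ≤ Real.log (3 / 2) - Real.log (2 - x) := by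
      rw [← Real.log_div (by norm_num) hx2.ne']
      have := Real.one_sub_inv_le_log_of_pos (x := 3 / 2 / (2 - x)) (by positivity)
      rw [inv_div] at this
      linarith
    have he : (x - 1 / 2) / 3 ≤ (Real.log (3 / 2) - Real.log (2 - x)) /
        (Real.log (3 / 2) - Real.log (1 / 2)) := by
      rw [hden, le_div_iff₀ hlog3']
      have : 0 ≤ x - 1 / 2 := by linarith [hx.1]
      nlinarith
    have he0 : 0 ≤ (x - 1 / 2) / 3 := by linarith [hx.1]
    calc _ ≤ ((Real.log T)⁻¹) ^ ((Real.log (3 / 2) - Real.log (2 - x)) /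
          (Real.log (3 / 2) - Real.log (1 / 2))) :=
        Real.rpow_le_rpow (by positivity) hbB (he0.trans he)
      _ ≤ ((Real.log T)⁻¹) ^ ((x - 1 / 2) / 3) :=
        Real.rpow_le_rpow_of_exponent_ge (by positivity) (inv_le_one_of_one_le₀ hlog1.le) he
      _ = q := by
        rw [Real.rpow_def_of_pos (by positivity), Real.log_inv, hq]
        congr 1
        ring
  -- The hypothesis on x gives q ≤ 1/e, small enough to invert the Möbius map.
  · rw [hq]
    have h1 : Real.exp (-((x - 1 / 2) * Real.log (Real.log T) / 3)) ≤ Real.exp (-1) :=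
      Real.exp_le_exp.2 (by linarith)
    have h2 : Real.exp (-1) ≤ 1 / 2 := by
      rw [Real.exp_neg, one_div]
      exact inv_anti₀ (by norm_num) (by linarith [Real.exp_one_gt_d9])
    linarith

-- Applied with v = z - ρ and v₁ = z₁ - ρ, where z₁ has abscissa 1/2 + h. The relative change of the
-- imaginary part is (a₁² - a²)/(a₁² + u²), with a, a₁ the real parts and u the common imaginary
-- part. It is at most a₁ Re(1/v₁), and the sum of Re(1/(z₁ - ρ)) over the zeros is controlled by
-- ζ'/ζ at z₁.
open Complex in
theorem abs_im_inv_sub_inv_le {v v₁ : ℂ} (him : v.im = v₁.im) (hne : v.im ≠ 0) (h0 : 0 ≤ v.re)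
    (h1 : v.re ≤ v₁.re) :
    |(v⁻¹ - v₁⁻¹).im| ≤ v₁.re * (v₁⁻¹).re * |(v⁻¹).im| := by
  have hu : 0 < v.im ^ 2 := by positivity
  have hn : 0 < v.re ^ 2 + v.im ^ 2 := by positivity
  have hn₁ : 0 < v₁.re ^ 2 + v.im ^ 2 := by positivity
  have e : (v⁻¹ - v₁⁻¹).im = (v⁻¹).im * ((v₁.re ^ 2 - v.re ^ 2) / (v₁.re ^ 2 + v.im ^ 2)) := by
    rw [sub_im, inv_im, inv_im, normSq_apply, normSq_apply, ← him, ← sq, ← sq, ← sq]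
    field_simp
    ring
  have e2 : v₁.re * (v₁⁻¹).re = v₁.re ^ 2 / (v₁.re ^ 2 + v.im ^ 2) := by
    rw [inv_re, normSq_apply, ← him, ← sq, ← sq]
    ring
  rw [e, e2, abs_mul, mul_comm]
  gcongr
  rw [abs_of_nonneg (div_nonneg (by nlinarith) hn₁.le)]
  gcongr
  nlinarith [sq_nonneg v.re]

open Complex in
/-- Under RH, the variation of `arg ζ` over the part of the segment close to the critical line. -/
theorem abs_integral_im_logDeriv_riemannZeta_near_le (hRH : RiemannHypothesis) {T h C K : ℝ}
    (hT : 3 ≤ T) (hT0 : ∀ s : ℂ, riemannZeta s = 0 → s.im ≠ T) (hh : 0 < h) (hh1 : h ≤ 3 / 2)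
    (hloc : ∀ z ∈ Metric.closedBall ((2 : ℂ) + T * I) (3 / 2), riemannZeta z ≠ 0 →
        ‖logDeriv riemannZeta z
          - ∑ ρ ∈ zetaZerosNear T, (analyticOrderNatAt riemannZeta ρ : ℂ) / (z - ρ)‖ ≤ C)
    (hK : ‖logDeriv riemannZeta ((1 / 2 + h : ℝ) + T * I)‖ ≤ K) :
    |∫ x in (1 / 2 : ℝ)..(1 / 2 + h), (logDeriv riemannZeta (x + T * I)).im|
      ≤ h * (K + 2 * C + 2 * Real.pi * (K + C)) := by
  set n : ℂ → ℝ := fun ρ => (analyticOrderNatAt riemannZeta ρ : ℝ) with hn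
  have hn0 : ∀ ρ, 0 ≤ n ρ := fun ρ => by positivity
  have hS : ∀ z : ℂ, ∑ ρ ∈ zetaZerosNear T, (analyticOrderNatAt riemannZeta ρ : ℂ) / (z - ρ)
      = ∑ ρ ∈ zetaZerosNear T, (n ρ : ℂ) * (z - ρ)⁻¹ := fun z => by
    simp only [hn, div_eq_mul_inv, ofReal_natCast]
  simp only [hS] at hloc
  set z₁ : ℂ := (1 / 2 + h : ℝ) + T * I with hz₁
  have hρ : ∀ ρ ∈ zetaZerosNear T, ρ.re = 1 / 2 ∧ T ≠ ρ.im := fun ρ hρ => by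
    obtain ⟨hρ1, hρ2⟩ := mem_zetaZerosNear.1 hρ
    have hρim : ρ.im ≠ 0 := by
      rw [Metric.mem_closedBall, dist_eq_norm] at hρ1
      have h2 := (abs_im_le_norm _).trans hρ1
      simp only [sub_im, add_im, mul_im, ofReal_re, ofReal_im, I_re, I_im, im_ofNat] at h2
      rw [abs_le] at h2
      linarith [h2.1]
    exact ⟨re_eq_half_of_riemannHypothesis hRH hρ2 hρim, (hT0 ρ hρ2).symm⟩
  have hzre : ∀ x : ℝ, (x + T * I : ℂ).re = x := fun x => by simp
  have hzim : ∀ x : ℝ, (x + T * I : ℂ).im = T := fun x => by simp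
  have hζ : ∀ x : ℝ, riemannZeta (x + T * I) ≠ 0 := fun x h0 => hT0 _ h0 (hzim x)
  have hloc₁ := hloc z₁ (horizontal_mem_closedBall ⟨by linarith, by linarith⟩) (hζ _)
  have hre₁ : ∀ ρ ∈ zetaZerosNear T, (z₁ - ρ).re = h := fun ρ hρ' => by
    rw [sub_re, hz₁, hzre, (hρ ρ hρ').1]; ring
  have hinv : ∀ ρ ∈ zetaZerosNear T, 0 ≤ ((z₁ - ρ)⁻¹).re := fun ρ hρ' => by
    rw [inv_re, hre₁ ρ hρ']
    exact div_nonneg hh.le (normSq_nonneg _)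
  -- Real part of Landau's approximation at z₁. This bounds the total weight, and the extra factor h
  -- is the saving over the unconditional bound.
  have hsum : ∑ ρ ∈ zetaZerosNear T, n ρ * ((z₁ - ρ)⁻¹).re ≤ K + C := by
    have h1 := (abs_re_le_norm _).trans hloc₁
    rw [sub_re, re_sum, abs_le] at h1
    simp only [re_ofReal_mul] at h1
    have h2 := (le_abs_self _).trans ((abs_re_le_norm _).trans hK)
    linarith [h1.1]
  have key := abs_integral_le_of_abs_le_add_sum (F := fun x : ℝ => (logDeriv riemannZeta (x + T * I)).im)
    (a := 1 / 2) (b := 1 / 2 + h) (t := T) (A := K + 2 * C) (by linarith) (Z := zetaZerosNear T)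
    (fun ρ hρ' => (hρ ρ hρ').2) (w := fun ρ => h * (n ρ * ((z₁ - ρ)⁻¹).re))
    (fun ρ hρ' => mul_nonneg hh.le (mul_nonneg (hn0 ρ) (hinv ρ hρ'))) (fun x hx => ?_)
  · refine key.trans ?_
    rw [← Finset.mul_sum]
    have := mul_le_mul_of_nonneg_left hsum (by positivity : 0 ≤ 2 * Real.pi * h)
    linarith
  · set z : ℂ := x + T * I with hz
    have hlocz := hloc z (horizontal_mem_closedBall ⟨hx.1, by linarith [hx.2]⟩) (hζ _)
    have h1 := (abs_im_le_norm _).trans hlocz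
    have h2 := (abs_im_le_norm _).trans hloc₁
    have h3 := (abs_im_le_norm _).trans hK
    -- Landau's approximations at z and z₁ are subtracted: the two errors cost 2C and the value at
    -- z₁ costs K.
    have h4 : |(∑ ρ ∈ zetaZerosNear T, (n ρ : ℂ) * (z - ρ)⁻¹).im
        - (∑ ρ ∈ zetaZerosNear T, (n ρ : ℂ) * (z₁ - ρ)⁻¹).im|
        ≤ ∑ ρ ∈ zetaZerosNear T, h * (n ρ * ((z₁ - ρ)⁻¹).re) * |((z - ρ)⁻¹).im| := by
      rw [im_sum, im_sum, ← Finset.sum_sub_distrib]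
      refine (Finset.abs_sum_le_sum_abs _ _).trans (Finset.sum_le_sum fun ρ hρ' => ?_)
      rw [im_ofReal_mul, im_ofReal_mul, ← mul_sub, ← sub_im, abs_mul, abs_of_nonneg (hn0 ρ)]
      have him : (z - ρ).im = (z₁ - ρ).im := by rw [sub_im, sub_im, hz, hz₁, hzim, hzim]
      have hne : (z - ρ).im ≠ 0 := by
        rw [sub_im, hz, hzim]; exact sub_ne_zero.2 (hρ ρ hρ').2
      have hre : (z - ρ).re = x - 1 / 2 := by rw [sub_re, hz, hzre, (hρ ρ hρ').1]
      have := abs_im_inv_sub_inv_le him hne (by rw [hre]; linarith [hx.1])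
        (by rw [hre, hre₁ ρ hρ']; linarith [hx.2])
      rw [hre₁ ρ hρ'] at this
      calc n ρ * |((z - ρ)⁻¹ - (z₁ - ρ)⁻¹).im|
          ≤ n ρ * (h * ((z₁ - ρ)⁻¹).re * |((z - ρ)⁻¹).im|) := by
            have := hn0 ρ
            gcongr
        _ = _ := by ring
    rw [sub_im] at h1 h2
    rw [abs_le] at h1 h2 h3 h4 ⊢
    constructor <;> linarith [h1.1, h1.2, h2.1, h2.2, h3.1, h3.2, h4.1, h4.2]

open Complex in
/-- Under RH, `S(T) = O(log T / log log T)`. -/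
theorem exists_abs_zetaArgVariation_le_of_riemannHypothesis (hRH : RiemannHypothesis) :
    ∃ C > 0, ∀ T : ℝ, Real.exp (Real.exp 3) ≤ T → (∀ s : ℂ, riemannZeta s = 0 → s.im ≠ T) →
      |zetaArgVariation T| ≤ C * (Real.log T / Real.log (Real.log T)) := by
  obtain ⟨C, hC, hl⟩ := exists_norm_logDeriv_riemannZeta_sub_sum_le
  obtain ⟨b, hb, hbound⟩ := exists_norm_logDeriv_riemannZeta_le
  obtain ⟨K, hK, hexp⟩ := exists_norm_logDeriv_riemannZeta_le_exp hRH
  have hpi := Real.pi_pos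
  refine ⟨3 * (K + 2 * C + 2 * Real.pi * (K + C)) + K * 3 + b, by positivity, fun T hT hT0 => ?_⟩
  have hT3 : 3 ≤ T := by
    have h1 := Real.add_one_le_exp (3 : ℝ)
    have h2 := Real.add_one_le_exp (Real.exp 3)
    linarith
  have hTpos : 0 < T := by linarith
  set L := Real.log T with hL
  set l := Real.log L with hl'
  have hL3 : Real.exp 3 ≤ L := (Real.le_log_iff_exp_le hTpos).2 hT
  have hLpos : 0 < L := (Real.exp_pos 3).trans_le hL3
  have hl3 : 3 ≤ l := (Real.le_log_iff_exp_le hLpos).2 hL3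
  have hl0 : 0 < l := by linarith
  have hlL : l ≤ L := (Real.log_le_sub_one_of_pos hLpos).trans (by linarith)
  have h1Ll : 1 ≤ L / l := (one_le_div hl0).2 hlL
  -- The least distance from the critical line at which the exponential bound is available; T ≥
  -- exp(exp 3) ensures h ≤ 1.
  set h := 3 / l with hh
  have hh0 : 0 < h := by positivity
  have hh1 : h ≤ 1 := (div_le_one hl0).2 hl3
  have hhl : h * l = 3 := by rw [hh]; field_simp
  have hcont := continuous_im.comp (continuous_logDeriv_riemannZeta_horizontal hTpos.ne' hT0)
  have hint : ∀ a b, IntervalIntegrable (fun x : ℝ => (logDeriv riemannZeta (x + T * I)).im)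
    MeasureTheory.volume a b := fun a b => hcont.intervalIntegrable a b
  have hzre : ∀ x : ℝ, (x + T * I : ℂ).re = x := fun x => by simp
  have hexp' : ∀ x ∈ Set.Icc (1 / 2 + h) (3 / 2), ‖logDeriv riemannZeta (x + T * I)‖
      ≤ K * L * Real.exp (-((x - 1 / 2) * l / 3)) := fun x hx =>
    hexp T hT3 hT0 x ⟨by linarith [hx.1], hx.2⟩ (by
      rw [← hL, ← hl', ← hhl]
      have := hx.1
      gcongr
      linarith)
  have p1 : |∫ x in (1 / 2 : ℝ)..(1 / 2 + h), (logDeriv riemannZeta (x + T * I)).im|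
      ≤ h * (K * L + 2 * (C * L) + 2 * Real.pi * (K * L + C * L)) := by
    refine abs_integral_im_logDeriv_riemannZeta_near_le hRH hT3 hT0 hh0 (by linarith)
      (hl T hT3).2 ((hexp' _ ⟨le_rfl, by linarith⟩).trans ?_)
    refine mul_le_of_le_one_right (by positivity) (Real.exp_le_one_iff.2 ?_)
    have : 0 ≤ (1 / 2 + h - 1 / 2) * l := by
      rw [add_sub_cancel_left]; positivity
    linarith
  have p2 : |∫ x in (1 / 2 + h)..(3 / 2 : ℝ), (logDeriv riemannZeta (x + T * I)).im|
      ≤ K * 3 * (L / l) := by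
    have hd : ∀ x : ℝ, HasDerivAt (fun x : ℝ => -(K * L * (3 / l)) * Real.exp (-((x - 1 / 2) * l / 3)))
        (K * L * Real.exp (-((x - 1 / 2) * l / 3))) x := fun x => by
      have h1 : HasDerivAt (fun x : ℝ => -((x - 1 / 2) * l / 3)) (-(1 * l / 3)) x :=
        ((((hasDerivAt_id x).sub_const _).mul_const l).div_const 3).neg
      refine (h1.exp.const_mul _).congr_deriv ?_
      field_simp
    have hgc : Continuous fun x : ℝ => K * L * Real.exp (-((x - 1 / 2) * l / 3)) := by fun_prop
    rw [← Real.norm_eq_abs]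
    refine (intervalIntegral.norm_integral_le_of_norm_le (by linarith)
      (g := fun x => K * L * Real.exp (-((x - 1 / 2) * l / 3)))
      (Eventually.of_forall fun x hx => (abs_im_le_norm _).trans
        (hexp' x (Set.Ioc_subset_Icc_self hx))) (hgc.intervalIntegrable _ _)).trans ?_
    rw [intervalIntegral.integral_eq_sub_of_hasDerivAt (fun x _ => hd x)
      (hgc.intervalIntegrable _ _)]
    have h1 : Real.exp (-((1 / 2 + h - 1 / 2) * l / 3)) ≤ 1 := Real.exp_le_one_iff.2 (by
      have : 0 ≤ (1 / 2 + h - 1 / 2) * l := by rw [add_sub_cancel_left]; positivity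
      linarith)
    have h2 := Real.exp_pos (-((3 / 2 - 1 / 2) * l / 3))
    have h3 : 0 < K * L * (3 / l) := by positivity
    have h4 : K * 3 * (L / l) = K * L * (3 / l) := by ring
    rw [h4]
    nlinarith
  have p3 : |∫ x in (3 / 2 : ℝ)..2, (logDeriv riemannZeta (x + T * I)).im| ≤ b * (L / l) := by
    rw [← Real.norm_eq_abs]
    refine (intervalIntegral.norm_integral_le_of_norm_le_const (C := b) fun x hx => ?_).trans ?_
    · rw [Set.uIoc_of_le (by norm_num)] at hx
      exact (abs_im_le_norm _).trans (hbound _ (by rw [hzre]; exact hx.1.le))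
    · rw [abs_of_nonneg (by norm_num)]
      nlinarith
  rw [zetaArgVariation, ← intervalIntegral.integral_add_adjacent_intervals
    (hint (1 / 2) (1 / 2 + h)) (hint (1 / 2 + h) 2),
    ← intervalIntegral.integral_add_adjacent_intervals (hint (1 / 2 + h) (3 / 2)) (hint (3 / 2) 2)]
  refine (abs_add_le _ _).trans ((add_le_add p1 ((abs_add_le _ _).trans (add_le_add p2 p3))).trans
    (le_of_eq ?_))
  rw [hh]
  ring

/-! ### Gram intervals in terms of ϑ. -/

/-- ϑ is increasing only from some T on. For n ≥ N the value π(n - 1) exceeds the maximum of ϑ on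
[0, T], so its root is unique and lies on the increasing branch, and comparing x with `gramPoint n`
is comparing values of ϑ. The finitely many earlier Gram points are bounded, and x is taken beyond
them. -/
theorem exists_inGramInterval_iff : ∃ X : ℝ, ∀ x, X ≤ x → ∀ m : ℕ,
    InGramInterval x m ↔ (m : ℝ) - 2 < rsTheta x / Real.pi ∧ rsTheta x / Real.pi ≤ m - 1 := by
  have hpi := Real.pi_pos
  obtain ⟨T, hT, hmono⟩ := exists_strictMonoOn_rsTheta
  obtain ⟨M, hM⟩ := (isCompact_Icc (a := 0) (b := T)).bddAbove_image
    continuous_rsTheta.continuousOn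
  have hM' : ∀ t, 0 ≤ t → t ≤ T → rsTheta t ≤ M := fun t h0 h1 => hM ⟨t, ⟨h0, h1⟩, rfl⟩
  have htop : Tendsto rsTheta atTop atTop :=
    tendsto_atTop_mono' _ ((eventually_mul_le_rsTheta 1).mono fun t ht => by simpa using ht)
      tendsto_id
  obtain ⟨N, hN⟩ := exists_nat_gt (M / Real.pi + 1)
  have hspec : ∀ n, N ≤ n →
      T ≤ gramPoint n ∧ rsTheta (gramPoint n) = Real.pi * ((n : ℝ) - 1) := by
    intro n hn
    have hMn : M < Real.pi * ((n : ℝ) - 1) := by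
      have : (N : ℝ) ≤ n := by exact_mod_cast hn
      rw [← div_lt_iff₀' hpi]; linarith
    obtain ⟨b, hb, hTb⟩ := ((htop.eventually_ge_atTop (Real.pi * ((n : ℝ) - 1))).and
      (eventually_ge_atTop T)).exists
    obtain ⟨t, ht, hteq⟩ := intermediate_value_Icc hTb continuous_rsTheta.continuousOn
      ⟨(hM' T hT.le le_rfl).trans hMn.le, hb⟩
    have hset : {t : ℝ | 0 < t ∧ rsTheta t = Real.pi * ((n : ℝ) - 1)} = {t} := by
      ext u
      constructor
      · rintro ⟨hu0, hu⟩
        rcases le_or_gt u T with huT | huT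
        · exact absurd (hM' u hu0.le huT) (by linarith)
        · exact hmono.injOn huT.le ht.1 (hu.trans hteq.symm)
      · rintro rfl
        exact ⟨hT.trans_le ht.1, hteq⟩
    have : gramPoint n = t := by rw [gramPoint, hset, csSup_singleton]
    rw [this]
    exact ⟨ht.1, hteq⟩
  obtain ⟨B, hB⟩ := ((Set.finite_lt_nat N).image gramPoint).bddAbove
  have hlt : ∀ x, T ≤ x → ∀ n, N ≤ n → (gramPoint n < x ↔ (n : ℝ) - 1 < rsTheta x / Real.pi) := by
    intro x hx n hn
    obtain ⟨h1, h2⟩ := hspec n hn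
    rw [← hmono.lt_iff_lt h1 hx, h2, lt_div_iff₀' hpi]
  obtain ⟨Y, hY⟩ := eventually_atTop.1 (htop.eventually_gt_atTop (Real.pi * N))
  refine ⟨max T (max (B + 1) Y), fun x hx m => ?_⟩
  have hxT : T ≤ x := (le_max_left _ _).trans hx
  have hxB : B < x := by
    linarith [(le_max_left (B + 1) Y).trans ((le_max_right T _).trans hx)]
  have hxN : (N : ℝ) < rsTheta x / Real.pi :=
    (lt_div_iff₀' hpi).2 (hY x ((le_max_right (B + 1) Y).trans ((le_max_right T _).trans hx)))
  constructor
  · rintro ⟨hm, h1, h2⟩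
    have hNm : N ≤ m := by
      by_contra! h
      exact absurd (hB ⟨m, h, rfl⟩) (by linarith)
    have h3 := not_lt.1 (mt (hlt x hxT m hNm).2 h2.not_gt)
    have hNm' : N ≤ m - 1 := by
      have : (N : ℝ) < m - 1 := hxN.trans_le h3
      have : (N : ℝ) + 1 < m := by linarith
      have : N + 1 < m := by exact_mod_cast this
      omega
    have h4 := (hlt x hxT (m - 1) hNm').1 h1
    rw [Nat.cast_sub hm] at h4
    push_cast at h4
    exact ⟨by linarith, h3⟩
  · rintro ⟨h1, h2⟩
    have : (N : ℝ) + 1 < m := by linarith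
    have hm : N + 1 < m := by exact_mod_cast this
    refine ⟨by omega, (hlt x hxT (m - 1) (by omega)).2 ?_, ?_⟩
    · rw [Nat.cast_sub (by omega)]
      push_cast
      linarith
    · exact not_lt.1 (mt (hlt x hxT m (by omega)).1 h2.not_gt)

theorem existsUnique_natCast_sub_lt {y : ℝ} (hy : 0 ≤ y) :
    ∃! m : ℕ, (m : ℝ) - 2 < y ∧ y ≤ m - 1 := by
  refine ⟨⌈y⌉₊ + 1, ⟨?_, ?_⟩, ?_⟩
  · push_cast
    linarith [Nat.ceil_lt_add_one hy]
  · push_cast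
    linarith [Nat.le_ceil y]
  · rintro m ⟨h1, h2⟩
    obtain ⟨k, rfl⟩ : ∃ k, m = k + 1 :=
      Nat.exists_eq_succ_of_ne_zero (by rintro rfl; norm_num at h2; linarith)
    push_cast at h1 h2
    congr 1
    apply le_antisymm
    · have : (k : ℝ) < ⌈y⌉₊ + 1 := by linarith [Nat.le_ceil y]
      exact Nat.lt_succ_iff.1 (by exact_mod_cast this)
    · exact Nat.ceil_le.2 (by linarith)

/-! ### Enumerations of the zeros and the counting function. -/

namespace IsZetaZeroEnumeration

variable {ρ : ℕ → ℂ}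

theorem finite_setOf_eq (h : IsZetaZeroEnumeration ρ) {s : ℂ} (hs : 0 < s.im) :
    {n : ℕ | 1 ≤ n ∧ ρ n = s}.Finite := by
  rw [← Set.encard_ne_top_iff, h.encard_eq s hs]
  exact analyticOrderAt_riemannZeta_ne_top (ne_one_of_im_ne_zero hs.ne')

theorem riemannZeta_eq_zero (h : IsZetaZeroEnumeration ρ) {n : ℕ} (hn : 1 ≤ n) :
    riemannZeta (ρ n) = 0 := by
  have h0 := h.im_pos n hn
  have h1 : {m : ℕ | 1 ≤ m ∧ ρ m = ρ n}.encard ≠ 0 :=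
    Set.encard_ne_zero.2 ⟨n, hn, rfl⟩
  rw [h.encard_eq _ h0] at h1
  exact apply_eq_zero_of_analyticOrderAt_ne_zero h1

theorem setOf_im_le_eq (h : IsZetaZeroEnumeration ρ) (T : ℝ) :
    {n : ℕ | 1 ≤ n ∧ (ρ n).im ≤ T} = ⋃ s ∈ zetaZerosUpTo T, {n : ℕ | 1 ≤ n ∧ ρ n = s} := by
  ext n
  simp only [Set.mem_ofPred_eq, Set.mem_iUnion, mem_zetaZerosUpTo, exists_prop]
  constructor
  · rintro ⟨h1, h2⟩
    exact ⟨ρ n, ⟨h.riemannZeta_eq_zero h1, h.im_pos n h1, h2⟩, h1, rfl⟩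
  · rintro ⟨s, hs, h1, rfl⟩
    exact ⟨h1, hs.2.2⟩

theorem finite_setOf_im_le (h : IsZetaZeroEnumeration ρ) (T : ℝ) :
    {n : ℕ | 1 ≤ n ∧ (ρ n).im ≤ T}.Finite := by
  rw [h.setOf_im_le_eq]
  exact (zetaZerosUpTo T).finite_toSet.biUnion fun s hs =>
    h.finite_setOf_eq (mem_zetaZerosUpTo.1 hs).2.1

theorem ncard_setOf_im_le (h : IsZetaZeroEnumeration ρ) (T : ℝ) :
    {n : ℕ | 1 ≤ n ∧ (ρ n).im ≤ T}.ncard = zetaZeroCount T := by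
  classical
  rw [Set.ncard_eq_toFinset_card _ (h.finite_setOf_im_le T),
    Finset.card_eq_sum_card_fiberwise (f := ρ) (t := zetaZerosUpTo T), zetaZeroCount]
  · refine Finset.sum_congr rfl fun s hs => ?_
    have hs' := mem_zetaZerosUpTo.1 hs
    rw [← Set.ncard_coe_finset, analyticOrderNatAt, ← h.encard_eq s hs'.2.1, Set.ncard]
    congr 2
    ext n
    simp only [Finset.coe_filter, Set.Finite.mem_toFinset, Set.mem_ofPred_eq]
    constructor
    · rintro ⟨⟨h1, -⟩, h2⟩; exact ⟨h1, h2⟩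
    · rintro ⟨h1, rfl⟩; exact ⟨⟨h1, hs'.2.2⟩, rfl⟩
  · intro n hn
    simp only [Set.Finite.coe_toFinset, Set.mem_ofPred_eq] at hn
    exact mem_zetaZerosUpTo.2 ⟨h.riemannZeta_eq_zero hn.1, h.im_pos n hn.1, hn.2⟩

theorem le_zetaZeroCount (h : IsZetaZeroEnumeration ρ) {n : ℕ} {T : ℝ}
    (hT : (ρ n).im ≤ T) : n ≤ zetaZeroCount T := by
  rw [← h.ncard_setOf_im_le]
  have := Set.ncard_le_ncard (s := (Finset.Icc 1 n : Set ℕ)) (t := {k | 1 ≤ k ∧ (ρ k).im ≤ T})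
    (fun k hk => by
      simp only [Finset.coe_Icc, Set.mem_Icc] at hk
      exact ⟨hk.1, (h.im_mono k n hk.1 hk.2).trans hT⟩) (h.finite_setOf_im_le T)
  rwa [Set.ncard_coe_finset, Nat.card_Icc, Nat.add_sub_cancel] at this

theorem zetaZeroCount_lt (h : IsZetaZeroEnumeration ρ) {n : ℕ} {T : ℝ} (hn : 1 ≤ n)
    (hT : T < (ρ n).im) : zetaZeroCount T < n := by
  rw [← h.ncard_setOf_im_le]
  have := Set.ncard_le_ncard (s := {k | 1 ≤ k ∧ (ρ k).im ≤ T}) (t := (Finset.Ico 1 n : Set ℕ))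
    (fun k hk => by
      simp only [Finset.coe_Ico, Set.mem_Ico]
      refine ⟨hk.1, ?_⟩
      by_contra! hnk
      exact absurd (h.im_mono n k hn hnk) (by linarith [hk.2])) (Finset.finite_toSet _)
  rw [Set.ncard_coe_finset, Nat.card_Ico] at this
  omega

theorem tendsto_im (h : IsZetaZeroEnumeration ρ) :
    Tendsto (fun n => (ρ n).im) atTop atTop := by
  refine tendsto_atTop.2 fun T => ?_
  filter_upwards [eventually_gt_atTop (zetaZeroCount T)] with n hn
  by_contra! hT
  exact absurd (h.le_zetaZeroCount hT.le) (by omega)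

/-- The bound for N is available only at heights that are not ordinates. Choosing such a < γ_n < b
gives N(a) < n ≤ N(b), whatever the multiplicity, and letting both be close to γ_n costs at most 1
by continuity of ϑ and E. -/
theorem eventually_abs_pi_mul_sub_rsTheta_le (h : IsZetaZeroEnumeration ρ) {E : ℝ → ℝ}
    (hcont : ∀ᶠ T in atTop, ContinuousAt E T)
    (hE : ∀ᶠ T in atTop, (∀ s : ℂ, riemannZeta s = 0 → s.im ≠ T) →
      |Real.pi * zetaZeroCount T - rsTheta T| ≤ E T) :
    ∀ᶠ n : ℕ in atTop, |Real.pi * n - rsTheta (ρ n).im| ≤ E (ρ n).im + 1 := by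
  obtain ⟨A, hA⟩ := eventually_atTop.1 hE
  filter_upwards [h.tendsto_im.eventually hcont, eventually_ge_atTop 1,
    h.tendsto_im.eventually_gt_atTop A, h.tendsto_im.eventually_gt_atTop 0] with n hc hn hnA hn0
  set x := (ρ n).im
  have hth : ContinuousAt rsTheta x := continuous_rsTheta.continuousAt
  have hup := (hth.add hc).eventually_lt_const (lt_add_one (rsTheta x + E x))
  have hlo := (hth.sub hc).eventually_const_lt (sub_one_lt (rsTheta x - E x))
  obtain ⟨δ, hδ, hδ'⟩ := Metric.eventually_nhds_iff.1 (hup.and hlo)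
  obtain ⟨a, ha, ha'⟩ := exists_mem_Ioo_not_ordinate (a := max (max A 0) (x - δ)) (b := x)
    ((le_max_right _ _).trans (le_max_left _ _)) (max_lt (max_lt hnA hn0) (by linarith))
  obtain ⟨b, hb, hb'⟩ := exists_mem_Ioo_not_ordinate (a := x) (b := x + δ) hn0.le (by linarith)
  have hmax := max_lt_iff.1 ha.1
  have h1 := (hδ' (y := b) (by rw [Real.dist_eq, abs_lt]; constructor <;> linarith [hb.1, hb.2])).1
  have h2 := (hδ' (y := a) (by
    rw [Real.dist_eq, abs_lt]; constructor <;> linarith [ha.2, hmax.2])).2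
  have h3 := abs_le.1 (hA b (by linarith [hb.1]) hb')
  have h4 := abs_le.1 (hA a (max_lt_iff.1 hmax.1).1.le ha')
  have h5 : (n : ℝ) ≤ zetaZeroCount b := by exact_mod_cast h.le_zetaZeroCount hb.1.le
  have h6 : (zetaZeroCount a : ℝ) ≤ n := by exact_mod_cast (h.zetaZeroCount_lt hn ha.2).le
  have h7 := mul_le_mul_of_nonneg_left h5 Real.pi_pos.le
  have h8 := mul_le_mul_of_nonneg_left h6 Real.pi_pos.le
  simp only [Pi.add_apply, Pi.sub_apply] at h1 h2
  rw [abs_le]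
  constructor <;> linarith

end IsZetaZeroEnumeration

/-! ### Existence of an enumeration. -/

/-- Ties of f are broken by an injection into ℕ. The resulting linear order has finite initial
segments and no maximum, hence is isomorphic to ℕ. -/
theorem exists_equiv_nat_monotone {P : Type*} [Infinite P] (f : P → ℝ)
    (hf : ∀ T, {p | f p ≤ T}.Finite) : ∃ e : ℕ ≃ P, Monotone (f ∘ e) := by
  have : Countable P := by
    rw [← Set.countable_univ_iff]
    refine (Set.countable_iUnion fun n : ℕ => (hf n).countable).mono fun p _ => ?_
    obtain ⟨n, hn⟩ := exists_nat_ge (f p)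
    exact Set.mem_iUnion.2 ⟨n, hn⟩
  obtain ⟨g, hg⟩ := exists_injective_nat P
  let F : P → ℝ ×ₗ ℕ := fun p => toLex (f p, g p)
  have hF : Function.Injective F := fun p q h => hg (congrArg (fun z => (ofLex z).2) h)
  let _ : LinearOrder P := LinearOrder.lift' F hF
  have hle : ∀ {p q : P}, p ≤ q → f p ≤ f q := fun {p q} h =>
    (Prod.Lex.toLex_le_toLex'.1 (show F p ≤ F q from h)).1
  have hIic : ∀ p : P, (Set.Iic p).Finite := fun p => (hf (f p)).subset fun q hq => hle hq
  let _ : LocallyFiniteOrder P := LocallyFiniteOrder.ofFiniteIcc fun a b =>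
    (hIic b).subset Set.Icc_subset_Iic_self
  let _ : SuccOrder P := LinearLocallyFiniteOrder.succOrder P
  let _ : PredOrder P := LinearLocallyFiniteOrder.predOrder P
  have : NoMaxOrder P := ⟨fun p => by
    by_contra! h
    exact Set.infinite_univ ((hIic p).subset fun q _ => h q)⟩
  obtain ⟨p₀⟩ := (inferInstance : Nonempty P)
  obtain ⟨b, hb, hmin⟩ := Set.exists_min_image (Set.Iic p₀) id (hIic p₀)
    ⟨p₀, Set.mem_Iic.2 le_rfl⟩
  let _ : OrderBot P :=
    { bot := b
      bot_le := fun q => (le_total q p₀).elim (fun h => hmin q h) fun h => le_trans hb h }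
  let e : P ≃o ℕ := orderIsoNatOfLinearSuccPredArch
  exact ⟨e.symm.toEquiv, fun m n h => hle (e.symm.monotone h)⟩

/-- Multiplicity is encoded by listing pairs (zero, copy number), with copy numbers below the order
of the zero. -/
theorem exists_isZetaZeroEnumeration (h : Tendsto zetaZeroCount atTop atTop) :
    ∃ ρ : ℕ → ℂ, IsZetaZeroEnumeration ρ := by
  let P := {p : ℂ × ℕ // riemannZeta p.1 = 0 ∧ 0 < p.1.im ∧
    p.2 < analyticOrderNatAt riemannZeta p.1}
  let f : P → ℝ := fun p => p.1.1.im
  let Z : ℝ → Finset (Σ _ : ℂ, ℕ) := fun T =>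
    (zetaZerosUpTo T).sigma fun s => Finset.range (analyticOrderNatAt riemannZeta s)
  have hZ : ∀ T, ((Z T : Finset _) : Set _) =
      (fun p : P => (⟨p.1.1, p.1.2⟩ : Σ _ : ℂ, ℕ)) '' {p | f p ≤ T} := by
    intro T
    ext ⟨s, k⟩
    simp only [Z, Finset.mem_coe, Finset.mem_sigma, mem_zetaZerosUpTo, Finset.mem_range]
    constructor
    · rintro ⟨⟨h1, h2, h3⟩, h4⟩
      exact ⟨⟨(s, k), h1, h2, h4⟩, h3, rfl⟩
    · rintro ⟨⟨⟨s', k'⟩, h1, h2, h4⟩, h3, heq⟩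
      obtain ⟨rfl, h5⟩ := Sigma.mk.inj_iff.1 heq
      obtain rfl := eq_of_heq h5
      exact ⟨⟨h1, h2, h3⟩, h4⟩
  have hinj : Function.Injective fun p : P => (⟨p.1.1, p.1.2⟩ : Σ _ : ℂ, ℕ) := by
    rintro ⟨⟨s, k⟩, _⟩ ⟨⟨s', k'⟩, _⟩ heq
    obtain ⟨h5, h6⟩ := Sigma.mk.inj_iff.1 heq
    exact Subtype.ext (Prod.ext h5 (eq_of_heq h6))
  have hfin : ∀ T, {p | f p ≤ T}.Finite := fun T =>
    Set.Finite.of_finite_image (hZ T ▸ Finset.finite_toSet _) hinj.injOn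
  have hcard : ∀ T, {p | f p ≤ T}.ncard = zetaZeroCount T := fun T => by
    rw [← Set.ncard_image_of_injective _ hinj, ← hZ, Set.ncard_coe_finset, Finset.card_sigma,
      zetaZeroCount]
    simp
  have : Infinite P := by
    by_contra hP
    rw [not_infinite_iff_finite] at hP
    obtain ⟨T, hT⟩ := (h.eventually_gt_atTop (Set.univ : Set P).ncard).exists
    rw [← hcard] at hT
    exact absurd (Set.ncard_le_ncard (Set.subset_univ _)) hT.not_ge
  obtain ⟨e, he⟩ := exists_equiv_nat_monotone f hfin
  -- The enumeration starts at 1, so indices shift by one; truncated subtraction gives index 0 a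
  -- harmless value.
  refine ⟨fun n => (e (n - 1)).1.1, fun n _ => (e (n - 1)).2.2.1, fun m n _ hmn =>
    he (Nat.sub_le_sub_right hmn 1), fun s hs => ?_⟩
  have hord := analyticOrderAt_riemannZeta_ne_top (ne_one_of_im_ne_zero hs.ne')
  rw [← Nat.cast_analyticOrderNatAt hord]
  let k : ℕ → ℕ := fun n => (e (n - 1)).1.2
  have hk : Set.BijOn k {n : ℕ | 1 ≤ n ∧ (e (n - 1)).1.1 = s}
      (Finset.range (analyticOrderNatAt riemannZeta s)) := by
    refine ⟨?_, ?_, ?_⟩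
    · rintro n ⟨-, rfl⟩
      simpa using (e (n - 1)).2.2.2
    · rintro n ⟨hn, hn'⟩ m ⟨hm, hm'⟩ hnm
      have : e (n - 1) = e (m - 1) := Subtype.ext (Prod.ext (hn'.trans hm'.symm) hnm)
      have := e.injective this
      omega
    · intro j hj
      have hj' : j < analyticOrderNatAt riemannZeta s := by simpa using hj
      have h0 : riemannZeta s = 0 := by
        refine apply_eq_zero_of_analyticOrderAt_ne_zero fun h0 => ?_
        rw [analyticOrderNatAt, h0] at hj'
        simp at hj'
      refine ⟨e.symm ⟨(s, j), h0, hs, hj'⟩ + 1, ⟨by omega, ?_⟩, ?_⟩ <;> simp [k]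
  rw [← hk.injOn.encard_image, hk.image_eq, Set.encard_coe_eq_coe_finsetCard, Finset.card_range]

/-! ### From bounds on arg ζ to bounds on Δ_n. -/

theorem exists_eventually_abs_pi_mul_zetaZeroCount_sub_le {C : ℝ} {F : ℝ → ℝ}
    (hF : ∀ᶠ T in atTop, (∀ s : ℂ, riemannZeta s = 0 → s.im ≠ T) →
      |zetaArgVariation T| ≤ C * F T) :
    ∃ D : ℝ, ∀ᶠ T in atTop, (∀ s : ℂ, riemannZeta s = 0 → s.im ≠ T) →
      |Real.pi * zetaZeroCount T - rsTheta T| ≤ C * F T + D := by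
  obtain ⟨D, hD⟩ := exists_abs_pi_mul_zetaZeroCount_sub_le
  refine ⟨D, ?_⟩
  filter_upwards [hF, eventually_ge_atTop 1] with T h1 h2 hT
  have h3 := abs_sub (Real.pi * zetaZeroCount T - rsTheta T + zetaArgVariation T)
    (zetaArgVariation T)
  rw [add_sub_cancel_right] at h3
  linarith [hD T h2 hT, h1 hT]

theorem tendsto_zetaZeroCount {C D : ℝ}
    (h : ∀ᶠ T in atTop, (∀ s : ℂ, riemannZeta s = 0 → s.im ≠ T) →
      |Real.pi * zetaZeroCount T - rsTheta T| ≤ C * Real.log T + D) :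
    Tendsto zetaZeroCount atTop atTop := by
  refine tendsto_atTop.2 fun n => ?_
  have hlim : ∀ᶠ T : ℝ in atTop, Real.pi * n ≤ rsTheta T - (C * Real.log T + D) := by
    filter_upwards [eventually_mul_le_rsTheta 2,
      (Real.isLittleO_log_id_atTop.const_mul_left C).bound one_pos,
      eventually_ge_atTop (Real.pi * n + D), eventually_ge_atTop 0] with T h1 h2 h3 h4
    rw [Real.norm_eq_abs, Real.norm_eq_abs, id, abs_of_nonneg h4] at h2
    linarith [le_abs_self (C * Real.log T)]
  obtain ⟨A, hA⟩ := eventually_atTop.1 (h.and hlim)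
  obtain ⟨T, hT, hT'⟩ := exists_mem_Ioo_not_ordinate (le_max_right A 0) (lt_add_one (max A 0))
  obtain ⟨h1, h2⟩ := hA T ((le_max_left _ _).trans hT.1.le)
  have h3 := (abs_le.1 (h1 hT')).1
  have h4 : Real.pi * n ≤ Real.pi * zetaZeroCount T := by linarith
  have h5 : n ≤ zetaZeroCount T := by exact_mod_cast le_of_mul_le_mul_left h4 Real.pi_pos
  filter_upwards [eventually_ge_atTop T] with t ht
  exact h5.trans (zetaZeroCount_mono ht)

namespace IsZetaZeroEnumeration

variable {ρ : ℕ → ℂ}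

theorem eventually_existsUnique_inGramInterval (h : IsZetaZeroEnumeration ρ) :
    ∀ᶠ n : ℕ in atTop, ∃! m : ℕ, InGramInterval (ρ n).im m := by
  obtain ⟨X, hX⟩ := exists_inGramInterval_iff
  filter_upwards [h.tendsto_im.eventually_ge_atTop X, h.tendsto_im.eventually_ge_atTop 0,
    h.tendsto_im.eventually (eventually_mul_le_rsTheta 0)] with n h1 h2 h3
  simp only [hX _ h1]
  exact existsUnique_natCast_sub_lt (div_nonneg (by simpa using h3) Real.pi_pos.le)

/-- The Gram index m satisfies ϑ/π + 1 ≤ m < ϑ/π + 2, whence the 2; dividing the error by π > 1 only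
helps. -/
theorem eventually_abs_gramDeviation_le (h : IsZetaZeroEnumeration ρ) {B : ℕ → ℝ}
    (hB : ∀ᶠ n : ℕ in atTop, |Real.pi * n - rsTheta (ρ n).im| ≤ B n) :
    ∀ᶠ n : ℕ in atTop, |(gramDeviation (fun k => (ρ k).im) n : ℝ)| ≤ B n + 2 := by
  obtain ⟨X, hX⟩ := exists_inGramInterval_iff
  filter_upwards [h.tendsto_im.eventually_ge_atTop X, h.eventually_existsUnique_inGramInterval,
    hB] with n h1 h2 h3
  have hex : ∃ m : ℕ, InGramInterval (ρ n).im m := h2.exists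
  rw [gramDeviation, dif_pos hex]
  obtain ⟨h4, h5⟩ := (hX _ h1 _).1 hex.choose_spec
  have h6 : |(n : ℝ) - rsTheta (ρ n).im / Real.pi| ≤ B n := by
    refine le_trans ?_ h3
    have : Real.pi * n - rsTheta (ρ n).im = Real.pi * (n - rsTheta (ρ n).im / Real.pi) := by
      field_simp
    rw [this, abs_mul, abs_of_pos Real.pi_pos]
    exact le_mul_of_one_le_left (abs_nonneg _) (by linarith [Real.pi_gt_three])
  push_cast
  have h7 := abs_le.1 h6
  rw [abs_le]
  constructor <;> linarith

/-- Superlinear growth of ϑ gives π γ_n ≤ ϑ(γ_n) - error ≤ π n. This crude bound suffices to replace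
F(γ_n) by F(n). -/
theorem eventually_im_le (h : IsZetaZeroEnumeration ρ) {C D : ℝ}
    (hB : ∀ᶠ n : ℕ in atTop,
      |Real.pi * n - rsTheta (ρ n).im| ≤ C * Real.log (ρ n).im + D) :
    ∀ᶠ n : ℕ in atTop, (ρ n).im ≤ n := by
  have hlim : ∀ᶠ T : ℝ in atTop, Real.pi * T ≤ rsTheta T - (C * Real.log T + D) := by
    filter_upwards [eventually_mul_le_rsTheta (Real.pi + 2),
      (Real.isLittleO_log_id_atTop.const_mul_left C).bound one_pos,
      eventually_ge_atTop D, eventually_ge_atTop 0] with T h1 h2 h3 h4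
    rw [Real.norm_eq_abs, Real.norm_eq_abs, id, abs_of_nonneg h4] at h2
    linarith [le_abs_self (C * Real.log T)]
  filter_upwards [hB, h.tendsto_im.eventually hlim] with n h1 h2
  exact le_of_mul_le_mul_left (by linarith [(abs_le.1 h1).1]) Real.pi_pos

/-- Stated for general F to serve both log and log / log log; F ≥ 1 absorbs the additive constants.
-/
theorem isBigO_gramDeviation (h : IsZetaZeroEnumeration ρ) {F : ℝ → ℝ} {C D : ℝ} (hC : 0 ≤ C)
    (hcont : ∀ᶠ T in atTop, ContinuousAt F T) (hF : ∀ᶠ T in atTop, 1 ≤ F T)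
    (hmono : ∀ᶠ S in atTop, ∀ T, S ≤ T → F S ≤ F T)
    (him : ∀ᶠ n : ℕ in atTop, (ρ n).im ≤ n)
    (hN : ∀ᶠ T in atTop, (∀ s : ℂ, riemannZeta s = 0 → s.im ≠ T) →
      |Real.pi * zetaZeroCount T - rsTheta T| ≤ C * F T + D) :
    (fun n : ℕ => (gramDeviation (fun k => (ρ k).im) n : ℝ)) =O[atTop] fun n : ℕ => F n := by
  have h1 := h.eventually_abs_gramDeviation_le (h.eventually_abs_pi_mul_sub_rsTheta_le
    (E := fun T => C * F T + D)
    (hcont.mono fun T hT => (continuousAt_const.mul hT).add continuousAt_const) hN)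
  refine IsBigO.of_bound (C + (|D| + 3)) ?_
  filter_upwards [h1, him, h.tendsto_im.eventually hmono,
    tendsto_natCast_atTop_atTop.eventually hF] with n h2 h3 h4 h5
  rw [Real.norm_eq_abs, Real.norm_eq_abs, abs_of_nonneg (zero_le_one.trans h5), add_mul]
  have h6 := mul_le_mul_of_nonneg_left (h4 _ h3) hC
  have h7 : |D| + 3 ≤ (|D| + 3) * F n := le_mul_of_one_le_right (by positivity) h5
  linarith [le_abs_self D]

end IsZetaZeroEnumeration

/-- The function y / log y increases for y ≥ e; here y = log T. -/
theorem log_div_log_log_mono {S T : ℝ} (hS : Real.exp (Real.exp 1) ≤ S) (hST : S ≤ T) :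
    Real.log S / Real.log (Real.log S) ≤ Real.log T / Real.log (Real.log T) := by
  have hS0 : 0 < S := (Real.exp_pos _).trans_le hS
  have hlogS : Real.exp 1 ≤ Real.log S := (Real.le_log_iff_exp_le hS0).2 hS
  have hlog : Real.log S ≤ Real.log T := Real.log_le_log hS0 hST
  have h := Real.log_div_self_antitoneOn (a := Real.log S) (b := Real.log T) hlogS
    (hlogS.trans hlog) hlog
  have he : (1 : ℝ) < Real.exp 1 := by simp
  have hpos : 0 < Real.log (Real.log T) / Real.log T :=
    div_pos (Real.log_pos (by linarith)) (by linarith)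
  simpa using inv_anti₀ hpos h

theorem one_le_log_div_log_log {T : ℝ} (hT : Real.exp (Real.exp 1) ≤ T) :
    1 ≤ Real.log T / Real.log (Real.log T) := by
  have hlog : Real.exp 1 ≤ Real.log T :=
    (Real.le_log_iff_exp_le ((Real.exp_pos _).trans_le hT)).2 hT
  have he : (1 : ℝ) < Real.exp 1 := by simp
  rw [one_le_div (Real.log_pos (by linarith))]
  linarith [Real.log_le_sub_one_of_pos (show 0 < Real.log T by linarith)]

theorem continuousAt_log_div_log_log {T : ℝ} (hT : Real.exp (Real.exp 1) ≤ T) :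
    ContinuousAt (fun T => Real.log T / Real.log (Real.log T)) T := by
  have hT0 := (Real.exp_pos _).trans_le hT
  have hlog : Real.exp 1 ≤ Real.log T := (Real.le_log_iff_exp_le hT0).2 hT
  have he : (1 : ℝ) < Real.exp 1 := by simp
  exact (Real.continuousAt_log hT0.ne').div
    ((Real.continuousAt_log hT0.ne').log (by linarith)) (Real.log_pos (by linarith)).ne'

theorem theorem1 :
    (∃ ρ : ℕ → ℂ, IsZetaZeroEnumeration ρ) ∧
    ∀ ρ : ℕ → ℂ, IsZetaZeroEnumeration ρ →
      (∀ᶠ n : ℕ in atTop, ∃! m : ℕ, InGramInterval (ρ n).im m) ∧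
      ((fun n : ℕ => (gramDeviation (fun k => (ρ k).im) n : ℝ))
        =O[atTop] fun n : ℕ => Real.log n) ∧
      (RiemannHypothesis →
        (fun n : ℕ => (gramDeviation (fun k => (ρ k).im) n : ℝ))
          =O[atTop] fun n : ℕ => Real.log n / Real.log (Real.log n)) := by
  obtain ⟨C, hC, hCb⟩ := exists_abs_zetaArgVariation_le
  obtain ⟨D, hD⟩ := exists_eventually_abs_pi_mul_zetaZeroCount_sub_le
    ((eventually_ge_atTop 3).mono hCb)
  have hcont : ∀ᶠ T in atTop, ContinuousAt Real.log T :=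
    (eventually_ne_atTop 0).mono fun T hT => Real.continuousAt_log hT
  refine ⟨exists_isZetaZeroEnumeration (tendsto_zetaZeroCount hD), fun ρ h => ?_⟩
  -- Obtained from the unconditional bound and used again in the conditional case.
  have him : ∀ᶠ n : ℕ in atTop, (ρ n).im ≤ n := by
    refine h.eventually_im_le (C := C) (D := D + 1) ?_
    filter_upwards [h.eventually_abs_pi_mul_sub_rsTheta_le
      (E := fun T => C * Real.log T + D)
      (hcont.mono fun T hT => (continuousAt_const.mul hT).add continuousAt_const) hD] with n hn
    linarith
  refine ⟨h.eventually_existsUnique_inGramInterval, ?_, fun hRH => ?_⟩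
  · exact h.isBigO_gramDeviation hC.le hcont (Real.tendsto_log_atTop.eventually_ge_atTop 1)
      ((eventually_gt_atTop 0).mono fun S hS T hST => Real.log_le_log hS hST) him hD
  · obtain ⟨C', hC', hCb'⟩ := exists_abs_zetaArgVariation_le_of_riemannHypothesis hRH
    obtain ⟨D', hD'⟩ := exists_eventually_abs_pi_mul_zetaZeroCount_sub_le
      ((eventually_ge_atTop _).mono hCb')
    exact h.isBigO_gramDeviation hC'.le
      ((eventually_ge_atTop _).mono fun T => continuousAt_log_div_log_log)
      ((eventually_ge_atTop _).mono fun T => one_le_log_div_log_log)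
      ((eventually_ge_atTop _).mono fun S hS T => log_div_log_log_mono hS) him hD'
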